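/- Let $\mathcal P$ be one of the five Platonic solids, with vertex set $V(\mathcal P)$ and set $F(\mathcal P)$ of two-dimensional faces, each face being regarded as the set of its vertices. Put $$F_{\mathcal P}=\sum_{F\in F(\mathcal P)}\ \prod_{v\in F}x_v\in\mathbb R[x_v\mid v\in V(\mathcal P)],\qquad A_{\mathcal P}=\mathbb R[\partial_v\mid v\in V(\mathcal P)]/\operatorname{Ann}(F_{\mathcal P}),$$ where $\partial_v$ acts as $\partial/\partial x_v$ and $\operatorname{Ann}(F_{\mathcal P})=\{f\in\mathbb R[\partial_v]\mid fF_{\mathcal P}=0\}$. Let $s=\deg F_{\mathcal P}$ and let $A_{\mathcal P}=\bigoplus_{k=0}^{s}A_k$ be the grading by degree. An element $\ell\in A_1$ is a *strong Lefschetz element* if $\times\ell^{s-2k}\colon A_k\to A_{s-k}$ is bijective for every integer $0\le k\le s/2$; $A_{\mathcal P}$ has the *strong Lefschetz property* if such an $\ell$ exists. $A_{\mathcal P}$ satisfies the *Hodge–Riemann relation with respect to* $\ell\in A_1$ if, for every integer $0\le k\le s/2$, the form $(f,g)\mapsto(-1)^k\,(f\,\ell^{s-2k}g)F_{\mathcal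 P}\in\mathbb R$ on $A_k$ is positive definite on the kernel of $\times\ell^{s-2k+1}\colon A_k\to A_{s-k+1}$. For $a\in\mathbb R^{V(\mathcal P)}$ write $\ell_a=\sum_{v}a_v\partial_v\in A_1$. Theorem. 1. For each of the five Platonic solids $\mathcal P$, the algebra $A_{\mathcal P}$ has the strong Lefschetz property. 2. If $\mathcal P$ is the regular tetrahedron or octahedron, then for every $a$ in the positive orthant ($a_v>0$ for all $v$) the element $\ell_a$ is a strong Lefschetz element, and $A_{\mathcal P}$ satisfies the Hodge–Riemann relation with respect to $\ell_a$. 3. If $\mathcal P$ is the cube or the regular icosahedron, then $\sum_{v\in V(\mathcal P)}\partial_v$ is a strong Lefschetz element, but $A_{\mathcal P}$ does not satisfy the Hodge–Riemann relation with respect to it. 4. If $\mathcal P$ is the regular dodecahedron, fix a face $\Phi$ and let $S$ be the set of the five vertices that do not lie on $\Phi$ but are joined to a vertex of $\Phi$ by an edge. Then $A_{\mathcal P}$ does not satisfy the Hodge–Riemann relation with respect to $\sum_{v\notin S}\partial_v$. Moreover there is an $a$ in the positive orthant such that $\ell_a$ is a strong Lefschetz element and $A_{\mathcal P}$ does not satisfy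 the Hodge–Riemann relation with respect to $\ell_a$. -/

import Mathlib

open MvPolynomial

noncomputable section

namespace Platonic

/-! ### Polynomials acting as differential operators, and the algebra `ℝ[∂] / Ann(F)` -/

section Macaulay

variable {σ : Type*}

/-- The partial derivative `∂ᵢ = ∂/∂xᵢ`, as a linear endomorphism of `ℝ[x]`. -/
def partialEnd (i : σ) : Module.End ℝ (MvPolynomial σ ℝ) :=
  (pderiv i).toLinearMap

theorem partialEnd_comm (i j : σ) : partialEnd i * partialEnd j = partialEnd j * partialEnd i := by
  have h : ⁅(pderiv i : Derivation ℝ (MvPolynomial σ ℝ) (MvPolynomial σ ℝ)),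
      (pderiv j : Derivation ℝ (MvPolynomial σ ℝ) (MvPolynomial σ ℝ))⁆ = 0 := by
    classical
    apply MvPolynomial.derivation_ext
    intro k
    simp only [Derivation.commutator_apply, pderiv_X, Derivation.coe_zero, Pi.zero_apply]
    by_cases h1 : k = i <;> by_cases h2 : k = j <;> simp [Pi.single_apply, h1, h2] <;>
      split_ifs <;> simp
  refine LinearMap.ext fun p => ?_
  have h2 := DFunLike.congr_fun h p
  rw [Derivation.commutator_apply, Derivation.coe_zero, Pi.zero_apply, sub_eq_zero] at h2
  exact h2

theorem adjoin_partialEnd_comm (a b : Algebra.adjoin ℝ (Set.range (partialEnd (σ := σ)))) :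
    a * b = b * a :=
  (Algebra.isMulCommutative_adjoin ℝ (by
    rintro _ ⟨i, rfl⟩ _ ⟨j, rfl⟩
    exact partialEnd_comm i j)).is_comm.comm a b

/-- The algebra homomorphism from `ℝ[∂ᵢ]` (a polynomial ring in the symbols `∂ᵢ = X i`) to the
endomorphisms of `ℝ[xᵢ]` that sends the symbol `X i` to the partial derivative `∂/∂xᵢ`.
It is evaluated inside the (commutative) algebra generated by the partial derivatives. -/
def diffOp : MvPolynomial σ ℝ →ₐ[ℝ] Module.End ℝ (MvPolynomial σ ℝ) :=
  letI : CommSemiring (Algebra.adjoin ℝ (Set.range (partialEnd (σ := σ)))) :=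
    { (Algebra.adjoin ℝ (Set.range (partialEnd (σ := σ)))).toSemiring with
      mul_comm := adjoin_partialEnd_comm }
  (Algebra.adjoin ℝ (Set.range (partialEnd (σ := σ)))).val.comp
    (aeval (S₁ := Algebra.adjoin ℝ (Set.range (partialEnd (σ := σ))))
      fun i => ⟨partialEnd i, Algebra.subset_adjoin ⟨i, rfl⟩⟩)

theorem diffOp_X (i : σ) (p : MvPolynomial σ ℝ) : diffOp (X i) p = pderiv i p := by
  simp [diffOp, partialEnd]

/-- The annihilator `Ann(F) = {f ∈ ℝ[∂] | f F = 0}`. -/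
def Ann (F : MvPolynomial σ ℝ) : Ideal (MvPolynomial σ ℝ) where
  carrier := {f | diffOp f F = 0}
  add_mem' {f g} hf hg := by
    have hf' : diffOp f F = 0 := hf
    have hg' : diffOp g F = 0 := hg
    simp [hf', hg']
  zero_mem' := by simp
  smul_mem' c f hf := by
    have hf' : diffOp f F = 0 := hf
    simp [hf']

/-- The algebra `A_F = ℝ[∂] / Ann(F)`. -/
abbrev AG (F : MvPolynomial σ ℝ) : Type _ := MvPolynomial σ ℝ ⧸ Ann F

/-- The homogeneous component of degree `k` of `ℝ[∂] / Ann(F)`: the classes of the homogeneous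
polynomials of degree `k` in the `∂ᵢ`. -/
def component (F : MvPolynomial σ ℝ) (k : ℕ) : Submodule ℝ (AG F) :=
  (homogeneousSubmodule σ ℝ k).map (Ideal.Quotient.mkₐ ℝ (Ann F)).toLinearMap

/-- The action of `ℝ[∂] / Ann(F)` on `F`: the class of `f` is sent to `f F`. -/
def applyTo (F : MvPolynomial σ ℝ) : AG F →ₗ[ℝ] MvPolynomial σ ℝ :=
  (((Ann F).restrictScalars ℝ).liftQ (diffOp.toLinearMap.flip F) (fun _ hf => hf)).comp
    (Submodule.Quotient.restrictScalarsEquiv ℝ (Ann F)).symm.toLinearMap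

theorem applyTo_mk (F f : MvPolynomial σ ℝ) :
    applyTo F (Ideal.Quotient.mk (Ann F) f) = diffOp f F := rfl

/-- The Poincaré duality `(f, g) ↦ f g F`. For `F` homogeneous of degree `s`, `f` of degree `k` and
`g` of degree `s - k`, the polynomial `f g F` is a constant, and this is its value. -/
def poincare (F : MvPolynomial σ ℝ) (f g : AG F) : ℝ :=
  constantCoeff (applyTo F (f * g))

/-- The linear element `ℓ_a = ∑ᵥ aᵥ ∂ᵥ`. -/
def linearElement [Fintype σ] (F : MvPolynomial σ ℝ) (a : σ → ℝ) : AG F :=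
  ∑ v, a v • Ideal.Quotient.mk (Ann F) (X v)

end Macaulay

/-! ### Strong Lefschetz property and Hodge–Riemann relation -/

section Lefschetz

variable {A : Type*} [CommRing A] [Algebra ℝ A]

/-- `ℓ` is a strong Lefschetz element of `A = ⨁_{k ≤ s} A_k`: it lies in `A₁`, and multiplication by
`ℓ ^ (s - 2k)` is a bijection from `A_k` to `A_{s-k}` for all `k ≤ s / 2`. -/
def IsStrongLefschetz (𝒜 : ℕ → Submodule ℝ A) (s : ℕ) (l : A) : Prop :=
  l ∈ 𝒜 1 ∧ ∀ k : ℕ, 2 * k ≤ s →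
    Set.BijOn (fun f => l ^ (s - 2 * k) * f) (𝒜 k : Set A) (𝒜 (s - k) : Set A)

/-- The Hodge–Riemann relation with respect to `ℓ` and the pairing `P`: for all `k ≤ s / 2` the form
`(f, g) ↦ (-1)ᵏ P(f, ℓ ^ (s - 2k) g)` is positive definite on the kernel of multiplication by
`ℓ ^ (s - 2k + 1)` on `A_k`. -/
def HodgeRiemann (𝒜 : ℕ → Submodule ℝ A) (P : A → A → ℝ) (s : ℕ) (l : A) : Prop :=
  ∀ k : ℕ, 2 * k ≤ s → ∀ f ∈ 𝒜 k, l ^ (s - 2 * k + 1) * f = 0 → f ≠ 0 →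
    0 < (-1) ^ k * P f (l ^ (s - 2 * k) * f)

end Lefschetz

/-! ### The five Platonic solids and their algebras -/

end Platonic

/-- The five Platonic solids. -/
inductive PlatonicSolid
  | tetrahedron
  | cube
  | octahedron
  | dodecahedron
  | icosahedron

namespace PlatonicSolid

open Platonic

/-- The number of vertices. -/
def numVertices : PlatonicSolid → ℕ
  | tetrahedron => 4
  | cube => 8
  | octahedron => 6
  | dodecahedron => 20
  | icosahedron => 12

/-- The vertices of a Platonic solid, labelled `0, …, n - 1`. -/
abbrev Vertex (P : PlatonicSolid) : Type := Fin P.numVertices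

def tetrahedronFaces : Finset (Finset (Fin 4)) :=
  {{0, 1, 2}, {0, 1, 3}, {0, 2, 3}, {1, 2, 3}}

def cubeFaces : Finset (Finset (Fin 8)) :=
  {{0, 1, 2, 3}, {1, 2, 5, 6}, {2, 3, 6, 7}, {0, 3, 4, 7}, {0, 1, 4, 5}, {4, 5, 6, 7}}

def octahedronFaces : Finset (Finset (Fin 6)) :=
  {{0, 1, 2}, {0, 2, 3}, {0, 3, 4}, {0, 1, 4}, {1, 2, 5}, {2, 3, 5}, {3, 4, 5}, {1, 4, 5}}

def dodecahedronFaces : Finset (Finset (Fin 20)) :=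
  {{0, 1, 2, 3, 4}, {0, 1, 5, 6, 18}, {1, 2, 6, 7, 19}, {2, 3, 7, 8, 15},
   {3, 4, 8, 9, 16}, {0, 4, 5, 9, 17}, {10, 11, 12, 13, 14}, {10, 11, 15, 16, 8},
   {11, 12, 16, 17, 9}, {12, 13, 17, 18, 5}, {13, 14, 18, 19, 6}, {10, 14, 15, 19, 7}}

def icosahedronFaces : Finset (Finset (Fin 12)) :=
  {{0, 1, 2}, {0, 2, 3}, {0, 3, 4}, {2, 3, 8}, {0, 4, 5},
   {0, 1, 5}, {1, 2, 7}, {2, 7, 8}, {1, 5, 6}, {1, 6, 7},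
   {9, 10, 11}, {3, 4, 9}, {3, 8, 9}, {4, 5, 10}, {4, 9, 10},
   {8, 9, 11}, {7, 8, 11}, {5, 6, 10}, {6, 10, 11}, {6, 7, 11}}

/-- The two-dimensional faces, each regarded as the set of its vertices. -/
def faces : (P : PlatonicSolid) → Finset (Finset P.Vertex)
  | tetrahedron => tetrahedronFaces
  | cube => cubeFaces
  | octahedron => octahedronFaces
  | dodecahedron => dodecahedronFaces
  | icosahedron => icosahedronFaces

/-- The face polynomial `F_P = ∑_F ∏_{v ∈ F} x_v`, summed over the faces `F` of `P`. -/
def facePoly (P : PlatonicSolid) : MvPolynomial P.Vertex ℝ :=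
  ∑ F ∈ P.faces, ∏ v ∈ F, X v

/-- The socle degree of `A_P`, that is, the degree of `F_P`. -/
def socleDegree (P : PlatonicSolid) : ℕ := P.facePoly.totalDegree

/-- The element `ℓ_a = ∑ᵥ aᵥ ∂ᵥ` of `A_P`. -/
def ell (P : PlatonicSolid) (a : P.Vertex → ℝ) : AG P.facePoly :=
  linearElement P.facePoly a

/-- `ℓ ∈ A_P` is a strong Lefschetz element. -/
def IsStrongLefschetzElement (P : PlatonicSolid) (l : AG P.facePoly) : Prop :=
  IsStrongLefschetz (component P.facePoly) P.socleDegree l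

/-- `A_P` has the strong Lefschetz property. -/
def HasStrongLefschetzProperty (P : PlatonicSolid) : Prop :=
  ∃ l : AG P.facePoly, P.IsStrongLefschetzElement l

/-- `A_P` satisfies the Hodge–Riemann relation with respect to `ℓ` and its Poincaré duality. -/
def SatisfiesHodgeRiemann (P : PlatonicSolid) (l : AG P.facePoly) : Prop :=
  HodgeRiemann (component P.facePoly) (poincare P.facePoly) P.socleDegree l

/-- The coefficients of `∑_{v ∉ S} ∂_v` on the dodecahedron, where `S = {5, 6, 7, 8, 9}` consists of
the vertices joined by an edge to the face `{0, 1, 2, 3, 4}` without lying on it. -/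
def dodecahedronWeight (v : dodecahedron.Vertex) : ℝ :=
  if 5 ≤ v.val ∧ v.val ≤ 9 then 0 else 1

end PlatonicSolid

end

noncomputable section

namespace Platonic

/-! ### Macaulay duality, and the Lefschetz and Hodge–Riemann conditions as statements about values
at `a`. -/

section Macaulay

variable {σ : Type*}

/-! Iterating Euler's identity gives `ℓ_a ^ n G = n! G(a)` for a form `G` of degree `n`. Hence for
`p, q` of degree `k` the pairing of `p` with `ℓ_a ^ (s - 2k) q` is `(s - 2k)!` times the value at
`a` of `p q F`. The strong Lefschetz property thus follows from nondegeneracy of these Hessian forms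
at `a` (`isStrongLefschetz_of_eval`), injectivity being enough because Poincaré duality equates the
dimensions of complementary degrees. In degree one the Hodge–Riemann relation says that the second
derivative along `c` is negative whenever the first derivative along `c` vanishes at `a` and `∂_c F
≠ 0`.

For the tetrahedron and the octahedron this negativity comes from an identity `(∂_c F)² - W · ∂_c² F
= sum of squares` with a positive factor `W`; the octahedron is easy since its `F` is a product of
three linear forms. Hodge–Riemann then yields strong Lefschetz. Conversely, Hodge–Riemann fails as
soon as one `c` has `∂_c F(a) = 0` and `∂_c² F(a) > 0`; explicit integer vectors do this for the
other solids.

Since all faces of a solid have the same size `s ≤ 5`, strong Lefschetz only needs `F(a) ≠ 0`, the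
Hessian, and for the dodecahedron the form in degree two. The substitution `c = a g` makes the face
weights `∏_{v ∈ T} a_v` the only coefficients, and nondegeneracy is certified by an explicit
integral inverse. In degree two of the dodecahedron a diagonal lies on just one face, so the
diagonals are eliminated pentagon by pentagon, leaving a symmetric system on the 30 edges. -/

theorem diffOp_mul (p q G : MvPolynomial σ ℝ) : diffOp (p * q) G = diffOp p (diffOp q G) := by
  rw [map_mul, Module.End.mul_apply]

theorem diffOp_comm (p q G : MvPolynomial σ ℝ) :
    diffOp p (diffOp q G) = diffOp q (diffOp p G) := by
  rw [← diffOp_mul, mul_comm, diffOp_mul]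

theorem diffOp_C (r : ℝ) (G : MvPolynomial σ ℝ) : diffOp (C r) G = r • G := by
  rw [← algebraMap_eq, AlgHom.commutes, Module.algebraMap_end_apply]

theorem diffOp_one (G : MvPolynomial σ ℝ) : diffOp 1 G = G := by
  rw [map_one, Module.End.one_apply]

theorem mk_eq_zero_iff (F p : MvPolynomial σ ℝ) :
    Ideal.Quotient.mk (Ann F) p = 0 ↔ diffOp p F = 0 :=
  Ideal.Quotient.eq_zero_iff_mem

theorem mem_component {F : MvPolynomial σ ℝ} {k : ℕ} {f : AG F} :
    f ∈ component F k ↔ ∃ p : MvPolynomial σ ℝ, p.IsHomogeneous k ∧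
      Ideal.Quotient.mk (Ann F) p = f :=
  Iff.rfl

theorem exists_eq_C {p : MvPolynomial σ ℝ} (hp : p.IsHomogeneous 0) : ∃ r, p = C r :=
  ⟨_, totalDegree_eq_zero_iff_eq_C.1 ((totalDegree_zero_iff_isHomogeneous σ).2 hp)⟩

variable [Fintype σ]

/-- The linear form `∑ᵥ aᵥ ∂ᵥ` in the polynomial ring. -/
def linForm (a : σ → ℝ) : MvPolynomial σ ℝ := ∑ v, a v • X v

theorem linForm_isHomogeneous (a : σ → ℝ) : (linForm a).IsHomogeneous 1 :=
  (homogeneousSubmodule σ ℝ 1).sum_mem fun v _ =>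
    (homogeneousSubmodule σ ℝ 1).smul_mem _ (isHomogeneous_X ℝ v)

theorem linearElement_eq_mk (F : MvPolynomial σ ℝ) (a : σ → ℝ) :
    linearElement F a = Ideal.Quotient.mk (Ann F) (linForm a) := by
  rw [linForm, map_sum]
  rfl

theorem diffOp_linForm (a : σ → ℝ) (G : MvPolynomial σ ℝ) :
    diffOp (linForm a) G = ∑ v, a v • pderiv v G := by
  simp [linForm, map_sum, map_smul, LinearMap.sum_apply, diffOp_X]

/-- A homogeneous polynomial of positive degree is a combination of variables with homogeneous
coefficients of one degree less. -/
theorem exists_eq_sum_X_mul {n : ℕ} {p : MvPolynomial σ ℝ} (hp : p.IsHomogeneous (n + 1)) :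
    ∃ q : σ → MvPolynomial σ ℝ, (∀ v, (q v).IsHomogeneous n) ∧ p = ∑ v, X v * q v := by
  refine ⟨fun v => ((n : ℝ) + 1)⁻¹ • pderiv v p, fun v => ?_, ?_⟩
  · exact (homogeneousSubmodule σ ℝ n).smul_mem _ (by simpa using hp.pderiv (i := v))
  · have h := hp.sum_X_mul_pderiv
    have hn : (n : ℝ) + 1 ≠ 0 := by positivity
    simp only [mul_smul_comm, ← Finset.smul_sum, h]
    rw [← Nat.cast_smul_eq_nsmul ℝ, smul_smul]
    push_cast
    rw [inv_mul_cancel₀ hn, one_smul]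

theorem exists_eq_linForm {p : MvPolynomial σ ℝ} (hp : p.IsHomogeneous 1) :
    ∃ c, p = linForm c := by
  obtain ⟨q, hq, rfl⟩ := exists_eq_sum_X_mul hp
  choose c hc using fun v => exists_eq_C (hq v)
  refine ⟨c, Finset.sum_congr rfl fun v _ => ?_⟩
  rw [hc, mul_comm, C_mul']

theorem exists_eq_sum_X_mul_linForm {p : MvPolynomial σ ℝ} (hp : p.IsHomogeneous 2) :
    ∃ b : σ → σ → ℝ, p = ∑ v, X v * linForm (b v) := by
  obtain ⟨q, hq, rfl⟩ := exists_eq_sum_X_mul hp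
  choose b hb using fun v => exists_eq_linForm (hq v)
  exact ⟨b, Finset.sum_congr rfl fun v _ => by rw [hb]⟩

theorem diffOp_isHomogeneous {k m : ℕ} {p G : MvPolynomial σ ℝ} (hp : p.IsHomogeneous k)
    (hG : G.IsHomogeneous (k + m)) : (diffOp p G).IsHomogeneous m := by
  induction k generalizing p G with
  | zero =>
    obtain ⟨r, rfl⟩ := exists_eq_C hp
    rw [diffOp_C]
    rw [zero_add] at hG
    exact (homogeneousSubmodule σ ℝ m).smul_mem _ hG
  | succ k ih =>
    obtain ⟨q, hq, rfl⟩ := exists_eq_sum_X_mul hp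
    rw [map_sum, LinearMap.sum_apply]
    refine (homogeneousSubmodule σ ℝ m).sum_mem fun v _ => ?_
    rw [mul_comm, diffOp_mul, diffOp_X]
    refine ih (hq v) ?_
    have := hG.pderiv (i := v)
    rwa [show k + 1 + m - 1 = k + m by omega] at this

/-- Euler's identity for directional derivatives. -/
theorem eval_diffOp_linForm {n : ℕ} {G : MvPolynomial σ ℝ} (hG : G.IsHomogeneous n) (a : σ → ℝ) :
    eval a (diffOp (linForm a) G) = n * eval a G := by
  have h := congrArg (eval a) hG.sum_X_mul_pderiv
  simpa [diffOp_linForm, map_sum] using h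

/-- Euler's identity, iterated. It converts every power of `ℓ_a` into evaluation at `a`. -/
theorem diffOp_linForm_pow {n : ℕ} {G : MvPolynomial σ ℝ} (hG : G.IsHomogeneous n) (a : σ → ℝ) :
    diffOp (linForm a ^ n) G = C (n.factorial * eval a G) := by
  induction n generalizing G with
  | zero =>
    obtain ⟨r, rfl⟩ := exists_eq_C hG
    simp
  | succ n ih =>
    rw [pow_succ, diffOp_mul, ih (diffOp_isHomogeneous (linForm_isHomogeneous a)
      (by rwa [add_comm])), eval_diffOp_linForm hG]
    push_cast [Nat.factorial_succ]
    ring_nf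

/-- Powers of linear forms are enough as test operators, since they recover all values of `G`. -/
theorem eq_zero_of_forall_diffOp {n : ℕ} {G : MvPolynomial σ ℝ} (hG : G.IsHomogeneous n)
    (h : ∀ q : MvPolynomial σ ℝ, q.IsHomogeneous n → constantCoeff (diffOp q G) = 0) : G = 0 := by
  refine MvPolynomial.funext fun a => ?_
  have := h (linForm a ^ n) (by simpa using (linForm_isHomogeneous a).pow n)
  rw [diffOp_linForm_pow hG, constantCoeff_C] at this
  simpa [Nat.factorial_ne_zero] using this

instance (F : MvPolynomial σ ℝ) (k : ℕ) : Module.Finite ℝ (component F k) :=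
  Module.Finite.iff_fg.2 ((homogeneousSubmodule_fg σ ℝ k).map _)

/-- The Poincaré duality as a bilinear form on complementary components. -/
def poincareLinear (F : MvPolynomial σ ℝ) (k m : ℕ) :
    component F k →ₗ[ℝ] Module.Dual ℝ (component F m) :=
  (((LinearMap.mul ℝ (AG F)).compr₂
    ((lcoeff ℝ (0 : σ →₀ ℕ)).comp (applyTo F))).domRestrict₁₂ (component F k) (component F m))

theorem poincareLinear_injective {F : MvPolynomial σ ℝ} {k m : ℕ}
    (hF : F.IsHomogeneous (k + m)) : Function.Injective (poincareLinear F k m) := by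
  rw [injective_iff_map_eq_zero]
  rintro ⟨f, hf⟩ h
  obtain ⟨p, hp, rfl⟩ := mem_component.1 hf
  rw [Subtype.ext_iff]
  refine (mk_eq_zero_iff F p).2 (eq_zero_of_forall_diffOp (diffOp_isHomogeneous hp hF) ?_)
  intro q hq
  have := LinearMap.congr_fun h ⟨_, mem_component.2 ⟨q, hq, rfl⟩⟩
  rw [← diffOp_mul, mul_comm]
  exact this

/-- Poincaré duality embeds one component into the dual of the other; exchanging the two degrees
gives equality. -/
theorem finrank_component_le {F : MvPolynomial σ ℝ} {k m : ℕ} (hF : F.IsHomogeneous (k + m)) :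
    Module.finrank ℝ (component F k) ≤ Module.finrank ℝ (component F m) := by
  rw [← Subspace.dual_finrank_eq (V := component F m)]
  exact LinearMap.finrank_le_finrank_of_injective (poincareLinear_injective hF)

theorem finrank_component_eq {F : MvPolynomial σ ℝ} {k m : ℕ} (hF : F.IsHomogeneous (k + m)) :
    Module.finrank ℝ (component F k) = Module.finrank ℝ (component F m) :=
  le_antisymm (finrank_component_le hF) (finrank_component_le (by rwa [add_comm]))

theorem pow_mul_mem_component {F : MvPolynomial σ ℝ} {k m : ℕ} (a : σ → ℝ) {f : AG F}
    (hf : f ∈ component F k) : linearElement F a ^ m * f ∈ component F (m + k) := by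
  obtain ⟨p, hp, rfl⟩ := mem_component.1 hf
  rw [linearElement_eq_mk, ← map_pow, ← map_mul]
  exact mem_component.2 ⟨_, (by simpa using ((linForm_isHomogeneous a).pow m).mul hp), rfl⟩

/-- Injectivity of the powers of `ℓ_a` suffices for the strong Lefschetz property. -/
theorem isStrongLefschetz_of_injective {F : MvPolynomial σ ℝ} {s : ℕ} (hF : F.IsHomogeneous s)
    (a : σ → ℝ)
    (h : ∀ k, 2 * k ≤ s → ∀ f ∈ component F k, linearElement F a ^ (s - 2 * k) * f = 0 → f = 0) :
    IsStrongLefschetz (component F) s (linearElement F a) := by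
  refine ⟨?_, fun k hk => ?_⟩
  · rw [linearElement_eq_mk]
    exact mem_component.2 ⟨_, linForm_isHomogeneous a, rfl⟩
  · have hmaps : ∀ f ∈ component F k,
        linearElement F a ^ (s - 2 * k) * f ∈ component F (s - k) := fun f hf => by
      have := pow_mul_mem_component (m := s - 2 * k) a hf
      rwa [show s - 2 * k + k = s - k by omega] at this
    let T : component F k →ₗ[ℝ] component F (s - k) :=
      (LinearMap.mulLeft ℝ (linearElement F a ^ (s - 2 * k))).restrict hmaps
    have hinj : Function.Injective T := by
      rw [injective_iff_map_eq_zero]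
      rintro ⟨f, hf⟩ h0
      exact Subtype.ext (h k hk f hf (congrArg Subtype.val h0))
    have hsurj := (LinearMap.injective_iff_surjective_of_finrank_eq_finrank
      (finrank_component_eq (F := F) (k := k) (m := s - k)
        (by rwa [show k + (s - k) = s by omega]))).1 hinj
    refine ⟨hmaps, fun f hf g hg hfg => ?_, fun g hg => ?_⟩
    · exact congrArg Subtype.val (hinj (a₁ := ⟨f, hf⟩) (a₂ := ⟨g, hg⟩) (Subtype.ext hfg))
    · obtain ⟨⟨f, hf⟩, hfg⟩ := hsurj ⟨g, hg⟩
      exact ⟨f, hf, congrArg Subtype.val hfg⟩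

theorem linearElement_pow_mul_mk_eq_zero_iff (F : MvPolynomial σ ℝ) (a : σ → ℝ) (m : ℕ)
    (p : MvPolynomial σ ℝ) : linearElement F a ^ m * Ideal.Quotient.mk (Ann F) p = 0 ↔
      diffOp (linForm a ^ m) (diffOp p F) = 0 := by
  rw [linearElement_eq_mk, ← map_pow, ← map_mul, mk_eq_zero_iff, diffOp_mul]

/-- The Hodge–Riemann relation implies the strong Lefschetz property. -/
theorem isStrongLefschetz_of_hodgeRiemann {F : MvPolynomial σ ℝ} {s : ℕ}
    (hF : F.IsHomogeneous s) (a : σ → ℝ)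
    (h : HodgeRiemann (component F) (poincare F) s (linearElement F a)) :
    IsStrongLefschetz (component F) s (linearElement F a) := by
  refine isStrongLefschetz_of_injective hF a fun k hk f hf h0 => ?_
  by_contra hne
  -- An element killed by `ℓ ^ (s - 2k)` is primitive, yet the form vanishes on it.
  have := h k hk f hf (by rw [pow_succ', mul_assoc, h0, mul_zero]) hne
  simp [h0, poincare] at this

/-- The Hessian criterion: nondegeneracy of the forms `(q, p) ↦ (q p F)(a)` suffices for the strong
Lefschetz property. -/
theorem isStrongLefschetz_of_eval {F : MvPolynomial σ ℝ} {s : ℕ} (hF : F.IsHomogeneous s)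
    (a : σ → ℝ)
    (h : ∀ k, 2 * k < s → ∀ p : MvPolynomial σ ℝ, p.IsHomogeneous k →
      (∀ q : MvPolynomial σ ℝ, q.IsHomogeneous k → eval a (diffOp q (diffOp p F)) = 0) →
      diffOp p F = 0) :
    IsStrongLefschetz (component F) s (linearElement F a) := by
  refine isStrongLefschetz_of_injective hF a fun k hk f hf h0 => ?_
  obtain ⟨p, hp, rfl⟩ := mem_component.1 hf
  rw [linearElement_pow_mul_mk_eq_zero_iff] at h0
  rw [mk_eq_zero_iff]
  -- In the middle degree the exponent `s - 2k` is zero and there is nothing to prove.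
  obtain hk' | hk' := hk.eq_or_lt
  · rwa [hk', Nat.sub_self, pow_zero, diffOp_one] at h0
  refine h k hk' p hp fun q hq => ?_
  have h1 : diffOp (linForm a ^ (s - 2 * k)) (diffOp q (diffOp p F)) = 0 := by
    rw [diffOp_comm, h0, map_zero]
  rw [diffOp_linForm_pow, C_eq_zero] at h1
  · simpa [Nat.factorial_ne_zero] using h1
  · refine diffOp_isHomogeneous hq (diffOp_isHomogeneous hp ?_)
    rwa [show k + (k + (s - 2 * k)) = s by omega]

/-- The Hodge–Riemann form is a positive multiple of the Hessian form at `a`, up to the sign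
`(-1)^k`. -/
theorem poincare_mk {F : MvPolynomial σ ℝ} {s k : ℕ} (hF : F.IsHomogeneous s) (hk : 2 * k ≤ s)
    (a : σ → ℝ) {p : MvPolynomial σ ℝ} (hp : p.IsHomogeneous k) :
    poincare F (Ideal.Quotient.mk (Ann F) p)
        (linearElement F a ^ (s - 2 * k) * Ideal.Quotient.mk (Ann F) p) =
      (s - 2 * k).factorial * eval a (diffOp p (diffOp p F)) := by
  rw [poincare, linearElement_eq_mk, ← map_pow, ← map_mul, ← map_mul, applyTo_mk,
    mul_left_comm, diffOp_mul, diffOp_mul p, diffOp_linForm_pow, constantCoeff_C]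
  refine diffOp_isHomogeneous hp (diffOp_isHomogeneous hp ?_)
  rwa [show k + (k + (s - 2 * k)) = s by omega]

/-- Here `ℓ_a ^ (s - 1)` is applied to a form of degree `s - 1`, so primitivity is a single scalar
equation. -/
theorem linForm_mem_primitive_iff {F : MvPolynomial σ ℝ} {s : ℕ} (hF : F.IsHomogeneous s)
    (hs : 2 ≤ s) (a c : σ → ℝ) :
    linearElement F a ^ (s - 2 * 1 + 1) * Ideal.Quotient.mk (Ann F) (linForm c) = 0 ↔
      eval a (diffOp (linForm c) F) = 0 := by
  rw [linearElement_pow_mul_mk_eq_zero_iff, diffOp_linForm_pow, C_eq_zero]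
  · simp [Nat.factorial_ne_zero]
  · refine diffOp_isHomogeneous (linForm_isHomogeneous c) ?_
    rwa [show 1 + (s - 2 * 1 + 1) = s by omega]

/-- The Hodge–Riemann relation for a cubic form. -/
theorem hodgeRiemann_cubic {F : MvPolynomial σ ℝ} (hF : F.IsHomogeneous 3) (a : σ → ℝ)
    (hpos : 0 < eval a F)
    (h : ∀ c : σ → ℝ, eval a (diffOp (linForm c) F) = 0 → diffOp (linForm c) F ≠ 0 →
      eval a (diffOp (linForm c) (diffOp (linForm c) F)) < 0) :
    HodgeRiemann (component F) (poincare F) 3 (linearElement F a) := by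
  intro k hk f hf h0 hne
  obtain ⟨p, hp, rfl⟩ := mem_component.1 hf
  rw [poincare_mk hF hk a hp]
  rw [Ne, mk_eq_zero_iff] at hne
  obtain rfl | rfl : k = 0 ∨ k = 1 := by omega
  · obtain ⟨r, rfl⟩ := exists_eq_C hp
    have hr : r ≠ 0 := by
      rintro rfl
      simp at hne
    have h2 : (0 : ℝ) < r * r := mul_self_pos.2 hr
    have h3 : (0 : ℝ) < (3 - 2 * 0).factorial * (r * r * eval a F) :=
      mul_pos (by positivity) (mul_pos h2 hpos)
    simpa [diffOp_C, smul_eval, mul_assoc] using h3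
  · obtain ⟨c, rfl⟩ := exists_eq_linForm hp
    rw [linForm_mem_primitive_iff hF (by norm_num)] at h0
    have := h c h0 hne
    norm_num
    exact this

/-- A primitive direction in which the Hessian of `F` is positive violates the Hodge–Riemann
relation. -/
theorem not_hodgeRiemann {F : MvPolynomial σ ℝ} {s : ℕ} (hF : F.IsHomogeneous s) (hs : 2 ≤ s)
    (a c : σ → ℝ) (h1 : eval a (diffOp (linForm c) F) = 0)
    (h2 : 0 < eval a (diffOp (linForm c) (diffOp (linForm c) F))) :
    ¬ HodgeRiemann (component F) (poincare F) s (linearElement F a) := by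
  intro h
  have hc := linForm_isHomogeneous c
  have h3 := h 1 (by omega) (Ideal.Quotient.mk (Ann F) (linForm c))
    (mem_component.2 ⟨_, hc, rfl⟩) ((linForm_mem_primitive_iff hF hs a c).2 h1) (by
      rw [Ne, mk_eq_zero_iff]
      intro h0
      simp [h0] at h2)
  rw [poincare_mk hF (by omega) a hc] at h3
  have : (0 : ℝ) < (s - 2 * 1).factorial * eval a (diffOp (linForm c) (diffOp (linForm c) F)) :=
    mul_pos (by positivity) h2
  linarith

end Macaulay

/-! ### Derivatives of squarefree polynomials of set families. -/

section Faces

variable {σ : Type*}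

/-- The squarefree polynomial `∑_T ∏_{v ∈ T} x_v` of a family of finite sets. -/
def setPoly (S : Finset (Finset σ)) : MvPolynomial σ ℝ := ∑ T ∈ S, ∏ v ∈ T, X v

theorem setPoly_isHomogeneous {S : Finset (Finset σ)} {s : ℕ} (h : ∀ T ∈ S, T.card = s) :
    (setPoly S).IsHomogeneous s := by
  refine IsHomogeneous.sum _ _ _ fun T hT => ?_
  have := IsHomogeneous.prod T (fun v => (X v : MvPolynomial σ ℝ)) (fun _ => 1)
    fun v _ => isHomogeneous_X ℝ v
  simpa [h T hT] using this

theorem eval_setPoly (S : Finset (Finset σ)) (a : σ → ℝ) :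
    eval a (setPoly S) = ∑ T ∈ S, ∏ v ∈ T, a v := by
  simp [setPoly, map_sum, map_prod]

theorem eval_setPoly_pos {S : Finset (Finset σ)} (hS : S.Nonempty) {a : σ → ℝ}
    (ha : ∀ v, 0 < a v) : 0 < eval a (setPoly S) := by
  rw [eval_setPoly]
  exact Finset.sum_pos (fun T _ => Finset.prod_pos fun v _ => ha v) hS

theorem totalDegree_setPoly {S : Finset (Finset σ)} {s : ℕ} (hS : S.Nonempty)
    (h : ∀ T ∈ S, T.card = s) : (setPoly S).totalDegree = s := by
  refine (setPoly_isHomogeneous h).totalDegree fun h0 => ?_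
  have := eval_setPoly_pos hS (a := fun _ => 1) fun _ => one_pos
  simp [h0] at this

theorem exists_eq_sum_symm [Fintype σ] {p : MvPolynomial σ ℝ} (hp : p.IsHomogeneous 2) :
    ∃ b : σ → σ → ℝ, (∀ u v, b u v = b v u) ∧ p = ∑ u, ∑ v, b u v • (X u * X v) := by
  obtain ⟨b, rfl⟩ := exists_eq_sum_X_mul_linForm hp
  refine ⟨fun u v => (1 / 2) * (b u v + b v u), fun u v => by ring, ?_⟩
  have h1 : ∑ v, X v * linForm (b v) = ∑ u, ∑ v, b u v • (X u * X v : MvPolynomial σ ℝ) := by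
    simp [linForm, Finset.mul_sum]
  have h2 : ∑ u, ∑ v, b v u • (X u * X v : MvPolynomial σ ℝ) =
      ∑ u, ∑ v, b u v • (X u * X v : MvPolynomial σ ℝ) := by
    rw [Finset.sum_comm]
    simp_rw [mul_comm]
  simp_rw [mul_smul, add_smul, smul_add, Finset.sum_add_distrib, ← Finset.smul_sum]
  rw [h2, ← h1, ← add_smul]
  norm_num

variable [DecidableEq σ]

theorem pderiv_prod_X (u : σ) (T : Finset σ) :
    pderiv u (∏ v ∈ T, X v : MvPolynomial σ ℝ) = if u ∈ T then ∏ v ∈ T.erase u, X v else 0 := by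
  induction T using Finset.induction_on with
  | empty => simp
  | insert w T hw ih =>
    rw [Finset.prod_insert hw, Derivation.leibniz, ih, pderiv_X]
    by_cases huw : u = w
    · subst huw
      simp [hw]
    · have h1 : w ∉ T.erase u := fun h => hw (Finset.mem_of_mem_erase h)
      by_cases hu : u ∈ T
      · simp [huw, hu, Finset.erase_insert_of_ne (Ne.symm huw), Finset.prod_insert h1]
      · simp [huw, hu]

theorem diffOp_X_mul_X_prod_X (p q : σ) (T : Finset σ) :
    diffOp (X p * X q) (∏ v ∈ T, X v) =
      if p ∈ T ∧ q ∈ T ∧ p ≠ q then ∏ v ∈ (T.erase q).erase p, X v else 0 := by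
  rw [diffOp_mul, diffOp_X, diffOp_X, pderiv_prod_X]
  by_cases hq : q ∈ T
  · rw [if_pos hq, pderiv_prod_X]
    simp only [Finset.mem_erase, hq, true_and, and_comm]
  · simp [hq]

/-- Covers squares `∂_p²` as well as pairs on no common set, so in degree two only pairs inside some
set matter. -/
theorem diffOp_X_mul_X_setPoly_eq_zero {S : Finset (Finset σ)} {p q : σ}
    (h : ∀ T ∈ S, p ∈ T → q ∈ T → p = q) : diffOp (X p * X q) (setPoly S) = 0 := by
  rw [setPoly, map_sum]
  refine Finset.sum_eq_zero fun T hT => ?_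
  rw [diffOp_X_mul_X_prod_X, if_neg fun h' => h'.2.2 (h T hT h'.1 h'.2.1)]

variable [Fintype σ]

theorem diffOp_linForm_prod_X (c : σ → ℝ) (T : Finset σ) :
    diffOp (linForm c) (∏ v ∈ T, X v) = ∑ u ∈ T, c u • ∏ v ∈ T.erase u, X v := by
  simp [diffOp_linForm, pderiv_prod_X, Finset.sum_ite_mem]

/-- In the coordinates `c = a g` each set contributes its weight times a plain sum. -/
theorem eval_diffOp_linForm_prod_X (a g : σ → ℝ) (T : Finset σ) :
    eval a (diffOp (linForm (a * g)) (∏ v ∈ T, X v)) = (∏ v ∈ T, a v) * ∑ v ∈ T, g v := by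
  rw [diffOp_linForm_prod_X, map_sum, Finset.mul_sum]
  refine Finset.sum_congr rfl fun u hu => ?_
  simp only [smul_eval, map_prod, eval_X, Pi.mul_apply]
  rw [← Finset.mul_prod_erase T a hu]
  ring

theorem eval_diffOp_X_linForm_setPoly (S : Finset (Finset σ)) (a g : σ → ℝ) (u : σ) :
    a u * eval a (diffOp (X u) (diffOp (linForm (a * g)) (setPoly S))) =
      ∑ T ∈ S with u ∈ T, (∏ v ∈ T, a v) * ∑ v ∈ T.erase u, g v := by
  rw [diffOp_comm, setPoly, map_sum, map_sum, map_sum, Finset.mul_sum, Finset.sum_filter]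
  refine Finset.sum_congr rfl fun T _ => ?_
  rw [diffOp_X, pderiv_prod_X]
  split_ifs with h
  · rw [eval_diffOp_linForm_prod_X, ← Finset.mul_prod_erase T a h, mul_assoc]
  · simp

/-- The second directional derivative of a set polynomial. -/
theorem eval_diffOp_linForm_linForm_setPoly (S : Finset (Finset σ)) (a c : σ → ℝ) :
    eval a (diffOp (linForm c) (diffOp (linForm c) (setPoly S))) =
      ∑ T ∈ S, ∑ u ∈ T, c u * ∑ w ∈ T.erase u, c w * ∏ v ∈ (T.erase u).erase w, a v := by
  rw [setPoly]
  simp_rw [map_sum, diffOp_linForm_prod_X, map_sum, map_smul, diffOp_linForm_prod_X]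
  simp [map_sum, smul_eval, map_prod]

theorem eval_diffOp_linForm_setPoly (S : Finset (Finset σ)) (a c : σ → ℝ) :
    eval a (diffOp (linForm c) (setPoly S)) =
      ∑ T ∈ S, ∑ u ∈ T, c u * ∏ v ∈ T.erase u, a v := by
  rw [setPoly]
  simp_rw [map_sum, diffOp_linForm_prod_X]
  simp [map_sum, smul_eval, map_prod]

theorem eval_diffOp_quadratic_prod_X (a : σ → ℝ) (d : σ → σ → ℝ) (T : Finset σ) :
    eval a (diffOp (∑ u, ∑ v, (a u * a v * d u v) • (X u * X v)) (∏ v ∈ T, X v)) =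
      (∏ v ∈ T, a v) * ∑ u ∈ T, ∑ v ∈ T.erase u, d u v := by
  simp_rw [map_sum, map_smul, LinearMap.sum_apply, LinearMap.smul_apply, diffOp_X_mul_X_prod_X,
    map_sum, smul_eval, Finset.mul_sum]
  rw [← Finset.sum_subset (Finset.subset_univ T)]
  · refine Finset.sum_congr rfl fun u hu => ?_
    rw [← Finset.sum_subset (Finset.subset_univ (T.erase u))]
    · refine Finset.sum_congr rfl fun v hv => ?_
      rw [Finset.mem_erase] at hv
      rw [if_pos ⟨hu, hv.2, hv.1.symm⟩, map_prod]
      simp only [eval_X]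
      rw [← Finset.mul_prod_erase T a hv.2,
        ← Finset.mul_prod_erase (T.erase v) a (Finset.mem_erase.2 ⟨hv.1.symm, hu⟩)]
      ring
    · intro v _ hv
      rw [if_neg (fun h => hv (Finset.mem_erase.2 ⟨h.2.2.symm, h.2.1⟩)), map_zero, mul_zero]
  · intro u _ hu
    refine Finset.sum_eq_zero fun v _ => ?_
    rw [if_neg (fun h => hu h.1), map_zero, mul_zero]

theorem eval_diffOp_X_mul_X_quadratic_setPoly (S : Finset (Finset σ)) (a : σ → ℝ)
    (d : σ → σ → ℝ) {p q : σ} (hpq : p ≠ q) :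
    a p * a q * eval a (diffOp (X p * X q)
        (diffOp (∑ u, ∑ v, (a u * a v * d u v) • (X u * X v)) (setPoly S))) =
      ∑ T ∈ S with p ∈ T ∧ q ∈ T, (∏ v ∈ T, a v) *
        ∑ u ∈ (T.erase q).erase p, ∑ v ∈ ((T.erase q).erase p).erase u, d u v := by
  rw [diffOp_comm, setPoly, map_sum (diffOp (X p * X q)), map_sum, map_sum (eval a),
    Finset.mul_sum, Finset.sum_filter]
  refine Finset.sum_congr rfl fun T _ => ?_
  rw [diffOp_X_mul_X_prod_X]
  by_cases h : p ∈ T ∧ q ∈ T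
  · rw [if_pos ⟨h.1, h.2, hpq⟩, if_pos h, eval_diffOp_quadratic_prod_X,
      ← Finset.mul_prod_erase T a h.2,
      ← Finset.mul_prod_erase (T.erase q) a (Finset.mem_erase.2 ⟨hpq, h.1⟩)]
    ring
  · rw [if_neg (fun h' => h ⟨h'.1, h'.2.1⟩), if_neg h, map_zero, map_zero, mul_zero]

/-- A linear-algebra criterion for the strong Lefschetz property of the algebra of a set polynomial
of degree at most five: two systems of linear equations, whose coefficients are the weights
`∏_{v ∈ T} a_v` of the sets, have only the trivial solution. -/
theorem isStrongLefschetz_setPoly {S : Finset (Finset σ)} {s : ℕ} (hS : S.Nonempty)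
    (hcard : ∀ T ∈ S, T.card = s) (hs : s ≤ 5) {a : σ → ℝ} (ha : ∀ v, 0 < a v)
    (h1 : ∀ g : σ → ℝ,
      (∀ u, ∑ T ∈ S with u ∈ T, (∏ v ∈ T, a v) * ∑ v ∈ T.erase u, g v = 0) → g = 0)
    (h2 : s = 5 → ∀ d : σ → σ → ℝ, (∀ u v, d u v = d v u) →
      (∀ p q, p ≠ q → ∑ T ∈ S with p ∈ T ∧ q ∈ T, (∏ v ∈ T, a v) *
        ∑ u ∈ (T.erase q).erase p, ∑ v ∈ ((T.erase q).erase p).erase u, d u v = 0) →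
      ∀ T ∈ S, ∀ u ∈ T, ∀ v ∈ T, u ≠ v → d u v = 0) :
    IsStrongLefschetz (component (setPoly S)) s (linearElement (setPoly S) a) := by
  refine isStrongLefschetz_of_eval (setPoly_isHomogeneous hcard) a fun k hk p hp h => ?_
  -- These are the only degrees with `2k < s ≤ 5`.
  obtain rfl | rfl | ⟨rfl, rfl⟩ : k = 0 ∨ k = 1 ∨ (k = 2 ∧ s = 5) := by omega
  · obtain ⟨r, rfl⟩ := exists_eq_C hp
    have h0 := h 1 (isHomogeneous_one _ _)
    rw [diffOp_one, diffOp_C, smul_eval] at h0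
    rw [diffOp_C, (mul_eq_zero.1 h0).resolve_right (eval_setPoly_pos hS ha).ne', zero_smul]
  · obtain ⟨c, rfl⟩ := exists_eq_linForm hp
    obtain ⟨g, rfl⟩ : ∃ g, c = a * g :=
      ⟨fun v => (a v)⁻¹ * c v, funext fun v => (mul_inv_cancel_left₀ (ha v).ne' _).symm⟩
    rw [h1 g fun u => ?_]
    · simp [linForm]
    · rw [← eval_diffOp_X_linForm_setPoly, h _ (isHomogeneous_X ℝ u), mul_zero]
  · obtain ⟨b, hb, rfl⟩ := exists_eq_sum_symm hp
    obtain ⟨d, rfl⟩ : ∃ d : σ → σ → ℝ, b = fun u v => a u * a v * d u v :=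
      ⟨fun u v => (a u * a v)⁻¹ * b u v, funext fun u => funext fun v =>
        (mul_inv_cancel_left₀ (mul_pos (ha u) (ha v)).ne' _).symm⟩
    have hd : ∀ u v, d u v = d v u := fun u v => by
      have : a u * a v * d u v = a v * a u * d v u := hb u v
      rw [mul_comm (a v)] at this
      exact mul_left_cancel₀ (mul_pos (ha u) (ha v)).ne' this
    have h3 := h2 rfl d hd fun p q hpq => by
      rw [← eval_diffOp_X_mul_X_quadratic_setPoly S a d hpq,
        h _ ((isHomogeneous_X ℝ p).mul (isHomogeneous_X ℝ q)), mul_zero]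
    simp_rw [map_sum, map_smul, LinearMap.sum_apply, LinearMap.smul_apply]
    refine Finset.sum_eq_zero fun u _ => Finset.sum_eq_zero fun v _ => ?_
    by_cases huv : ∀ T ∈ S, u ∈ T → v ∈ T → u = v
    · rw [diffOp_X_mul_X_setPoly_eq_zero huv, smul_zero]
    · push Not at huv
      obtain ⟨T, hT, hu, hv, hne⟩ := huv
      rw [h3 T hT u hu v hv hne, mul_zero, zero_smul]

/-- A violation of the Hodge–Riemann relation in degree one, with integral data. -/
theorem not_hodgeRiemann_setPoly {S : Finset (Finset σ)} {s : ℕ}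
    (hcard : ∀ T ∈ S, T.card = s) (hs : 2 ≤ s) (a c : σ → ℤ)
    (h1 : ∑ T ∈ S, ∑ u ∈ T, c u * ∏ v ∈ T.erase u, a v = 0)
    (h2 : 0 < ∑ T ∈ S, ∑ u ∈ T, c u * ∑ w ∈ T.erase u, c w * ∏ v ∈ (T.erase u).erase w, a v) :
    ¬ HodgeRiemann (component (setPoly S)) (poincare (setPoly S)) s
      (linearElement (setPoly S) fun v => (a v : ℝ)) := by
  refine not_hodgeRiemann (setPoly_isHomogeneous hcard) hs _ (fun v => (c v : ℝ)) ?_ ?_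
  · rw [eval_diffOp_linForm_setPoly]
    exact_mod_cast h1
  · rw [eval_diffOp_linForm_linForm_setPoly]
    exact_mod_cast h2

end Faces

/-! ### Explicit sums over triples, and integral inverses as certificates of nondegeneracy. -/

section Certificates

variable {σ : Type*} [DecidableEq σ]

theorem sum_triple {M : Type*} [AddCommMonoid M] {x y z : σ} (hxy : x ≠ y) (hxz : x ≠ z)
    (hyz : y ≠ z) (f : σ → M) : ∑ u ∈ ({x, y, z} : Finset σ), f u = f x + (f y + f z) := by
  rw [Finset.sum_insert (by simp [hxy, hxz]), Finset.sum_pair hyz]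

theorem erase_triple {x y z : σ} (hxy : x ≠ y) (hxz : x ≠ z) (hyz : y ≠ z) :
    ({x, y, z} : Finset σ).erase x = {y, z} ∧ ({x, y, z} : Finset σ).erase y = {x, z} ∧
      ({x, y, z} : Finset σ).erase z = {x, y} := by
  refine ⟨?_, ?_, ?_⟩ <;> ext w <;> simp only [Finset.mem_erase, Finset.mem_insert,
    Finset.mem_singleton] <;> grind

theorem erase_pair {x y : σ} (hxy : x ≠ y) :
    ({x, y} : Finset σ).erase x = {y} ∧ ({x, y} : Finset σ).erase y = {x} := by
  refine ⟨?_, ?_⟩ <;> ext w <;> simp only [Finset.mem_erase, Finset.mem_insert,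
    Finset.mem_singleton] <;> grind

theorem sum_erase_triple {x y z : σ} (hxy : x ≠ y) (hxz : x ≠ z) (hyz : y ≠ z)
    {d : σ → σ → ℝ} (hd : ∀ u v, d u v = d v u) :
    ∑ u ∈ ({x, y, z} : Finset σ), ∑ v ∈ ({x, y, z} : Finset σ).erase u, d u v =
      2 * (d x y + d x z + d y z) := by
  obtain ⟨h1, h2, h3⟩ := erase_triple hxy hxz hyz
  rw [sum_triple hxy hxz hyz, h1, h2, h3, Finset.sum_pair hyz, Finset.sum_pair hxz,
    Finset.sum_pair hxy, hd y x, hd z x, hd z y]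
  ring

theorem first_derivative_triple {x y z : σ} (hxy : x ≠ y) (hxz : x ≠ z) (hyz : y ≠ z)
    (a c : σ → ℝ) :
    ∑ u ∈ ({x, y, z} : Finset σ), c u * ∏ v ∈ ({x, y, z} : Finset σ).erase u, a v =
      c x * (a y * a z) + (c y * (a x * a z) + c z * (a x * a y)) := by
  obtain ⟨h1, h2, h3⟩ := erase_triple hxy hxz hyz
  rw [sum_triple hxy hxz hyz, h1, h2, h3, Finset.prod_pair hyz, Finset.prod_pair hxz,
    Finset.prod_pair hxy]

theorem second_derivative_triple {x y z : σ} (hxy : x ≠ y) (hxz : x ≠ z) (hyz : y ≠ z)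
    (a c : σ → ℝ) :
    ∑ u ∈ ({x, y, z} : Finset σ), c u * ∑ w ∈ ({x, y, z} : Finset σ).erase u,
        c w * ∏ v ∈ (({x, y, z} : Finset σ).erase u).erase w, a v =
      2 * (c x * c y * a z + c x * c z * a y + c y * c z * a x) := by
  obtain ⟨h1, h2, h3⟩ := erase_triple hxy hxz hyz
  obtain ⟨h4, h5⟩ := erase_pair hxy
  obtain ⟨h6, h7⟩ := erase_pair hxz
  obtain ⟨h8, h9⟩ := erase_pair hyz
  rw [sum_triple hxy hxz hyz, h1, h2, h3, Finset.sum_pair hyz, Finset.sum_pair hxz,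
    Finset.sum_pair hxy, h4, h5, h6, h7, h8, h9]
  simp only [Finset.prod_singleton]
  ring

variable [Fintype σ]

/-- The operator `g ↦ (u ↦ ∑_{T ∋ u} w_T ∑_{v ∈ T, v ≠ u} g_v)` is self-adjoint. -/
theorem sum_mul_sum_erase_comm (S : Finset (Finset σ)) (w : Finset σ → ℝ) (g h : σ → ℝ) :
    ∑ u, h u * ∑ T ∈ S with u ∈ T, w T * ∑ v ∈ T.erase u, g v =
      ∑ u, g u * ∑ T ∈ S with u ∈ T, w T * ∑ v ∈ T.erase u, h v := by
  -- Grouped by sets, the pairing is visibly symmetric in `g` and `h`.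
  have key : ∀ g h : σ → ℝ, ∑ u, h u * ∑ T ∈ S with u ∈ T, w T * ∑ v ∈ T.erase u, g v =
      ∑ T ∈ S, w T * ((∑ u ∈ T, h u) * (∑ u ∈ T, g u) - ∑ u ∈ T, h u * g u) := fun g h => by
    simp_rw [Finset.sum_filter, Finset.mul_sum S, mul_ite, mul_zero]
    rw [Finset.sum_comm]
    refine Finset.sum_congr rfl fun T _ => ?_
    rw [Finset.sum_ite_mem, Finset.univ_inter, Finset.sum_mul, ← Finset.sum_sub_distrib,
      Finset.mul_sum]
    refine Finset.sum_congr rfl fun u hu => ?_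
    rw [Finset.sum_erase_eq_sub hu]
    ring
  rw [key, key]
  refine Finset.sum_congr rfl fun T _ => ?_
  simp_rw [mul_comm]

/-- An integral left inverse certifies that the Hessian system has only the trivial solution. -/
theorem eq_zero_of_certificate {S : Finset (Finset σ)} {a : σ → ℤ} (N : σ → σ → ℤ) {d : ℤ}
    (hd : d ≠ 0)
    (hN : ∀ t v, ∑ T ∈ S with v ∈ T, (∏ u ∈ T, a u) * ∑ u ∈ T.erase v, N t u =
      if v = t then d else 0)
    {g : σ → ℝ}
    (h : ∀ u, ∑ T ∈ S with u ∈ T, (∏ v ∈ T, (a v : ℝ)) * ∑ v ∈ T.erase u, g v = 0) : g = 0 := by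
  funext t
  -- Pair the system with row `t` of `N`: by self-adjointness the operator moves onto the row and
  -- leaves `d * g t = 0`.
  have h1 := sum_mul_sum_erase_comm S (fun T => ∏ v ∈ T, (a v : ℝ)) g (fun u => (N t u : ℝ))
  simp_rw [h, mul_zero, Finset.sum_const_zero] at h1
  have h2 : ∀ v, ∑ T ∈ S with v ∈ T, (∏ u ∈ T, (a u : ℝ)) * ∑ u ∈ T.erase v, (N t u : ℝ) =
      if v = t then (d : ℝ) else 0 := fun v => by exact_mod_cast hN t v
  simp_rw [h2] at h1
  simpa [hd] using h1.symm

end Certificates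

end Platonic

/-! ### Specialization to the five solids. -/

namespace PlatonicSolid

open Platonic

/-- The number of vertices of a face. -/
def faceSize : PlatonicSolid → ℕ
  | tetrahedron => 3
  | cube => 4
  | octahedron => 3
  | dodecahedron => 5
  | icosahedron => 3

theorem card_of_mem_faces (P : PlatonicSolid) : ∀ T ∈ P.faces, T.card = P.faceSize := by
  rw [← Finset.filter_eq_self]
  cases P <;> decide +kernel

theorem faces_nonempty (P : PlatonicSolid) : P.faces.Nonempty := by
  cases P <;> exact Finset.insert_nonempty _ _

theorem socleDegree_eq (P : PlatonicSolid) : P.socleDegree = P.faceSize :=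
  totalDegree_setPoly P.faces_nonempty P.card_of_mem_faces

theorem isStrongLefschetzElement_ell_iff (P : PlatonicSolid) (a : P.Vertex → ℝ) :
    P.IsStrongLefschetzElement (P.ell a) ↔
      IsStrongLefschetz (component (setPoly P.faces)) P.faceSize
        (linearElement (setPoly P.faces) a) := by
  rw [IsStrongLefschetzElement, socleDegree_eq]
  rfl

theorem satisfiesHodgeRiemann_ell_iff (P : PlatonicSolid) (a : P.Vertex → ℝ) :
    P.SatisfiesHodgeRiemann (P.ell a) ↔
      HodgeRiemann (component (setPoly P.faces)) (poincare (setPoly P.faces)) P.faceSize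
        (linearElement (setPoly P.faces) a) := by
  rw [SatisfiesHodgeRiemann, socleDegree_eq]
  rfl

theorem isStrongLefschetzElement_of_satisfiesHodgeRiemann {P : PlatonicSolid}
    {a : P.Vertex → ℝ} (h : P.SatisfiesHodgeRiemann (P.ell a)) :
    P.IsStrongLefschetzElement (P.ell a) := by
  rw [isStrongLefschetzElement_ell_iff]
  exact isStrongLefschetz_of_hodgeRiemann (setPoly_isHomogeneous P.card_of_mem_faces) a
    ((satisfiesHodgeRiemann_ell_iff P a).1 h)

theorem not_satisfiesHodgeRiemann_ell {P : PlatonicSolid} (a c : P.Vertex → ℤ)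
    (h1 : ∑ T ∈ P.faces, ∑ u ∈ T, c u * ∏ v ∈ T.erase u, a v = 0)
    (h2 : 0 < ∑ T ∈ P.faces, ∑ u ∈ T, c u * ∑ w ∈ T.erase u, c w *
      ∏ v ∈ (T.erase u).erase w, a v) :
    ¬ P.SatisfiesHodgeRiemann (P.ell fun v => (a v : ℝ)) := by
  rw [satisfiesHodgeRiemann_ell_iff]
  exact not_hodgeRiemann_setPoly P.card_of_mem_faces (by cases P <;> decide) a c h1 h2

/-! ### The tetrahedron and the octahedron -/

theorem eval_diffOp_tetrahedron (a c : Fin 4 → ℝ) :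
    eval a (diffOp (linForm c) (setPoly tetrahedronFaces)) =
      (c 0 * (a 1 * a 2) + (c 1 * (a 0 * a 2) + c 2 * (a 0 * a 1))) +
      ((c 0 * (a 1 * a 3) + (c 1 * (a 0 * a 3) + c 3 * (a 0 * a 1))) +
      ((c 0 * (a 2 * a 3) + (c 2 * (a 0 * a 3) + c 3 * (a 0 * a 2))) +
      (c 1 * (a 2 * a 3) + (c 2 * (a 1 * a 3) + c 3 * (a 1 * a 2))))) := by
  rw [eval_diffOp_linForm_setPoly, tetrahedronFaces]
  iterate 3 rw [Finset.sum_insert (by decide), first_derivative_triple (by decide) (by decide) (by decide)]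
  rw [Finset.sum_singleton, first_derivative_triple (by decide) (by decide) (by decide)]

theorem eval_diffOp_diffOp_tetrahedron (a c : Fin 4 → ℝ) :
    eval a (diffOp (linForm c) (diffOp (linForm c) (setPoly tetrahedronFaces))) =
      2 * (c 0 * c 1 * a 2 + c 0 * c 2 * a 1 + c 1 * c 2 * a 0) +
      (2 * (c 0 * c 1 * a 3 + c 0 * c 3 * a 1 + c 1 * c 3 * a 0) +
      (2 * (c 0 * c 2 * a 3 + c 0 * c 3 * a 2 + c 2 * c 3 * a 0) +
      2 * (c 1 * c 2 * a 3 + c 1 * c 3 * a 2 + c 2 * c 3 * a 1))) := by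
  rw [eval_diffOp_linForm_linForm_setPoly, tetrahedronFaces]
  iterate 3 rw [Finset.sum_insert (by decide), second_derivative_triple (by decide) (by decide) (by decide)]
  rw [Finset.sum_singleton, second_derivative_triple (by decide) (by decide) (by decide)]

theorem tetrahedron_hessian_neg {a c : Fin 4 → ℝ} (ha : ∀ v, 0 < a v)
    (h1 : eval a (diffOp (linForm c) (setPoly tetrahedronFaces)) = 0)
    (hne : diffOp (linForm c) (setPoly tetrahedronFaces) ≠ 0) :
    eval a (diffOp (linForm c) (diffOp (linForm c) (setPoly tetrahedronFaces))) < 0 := by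
  obtain ⟨g, rfl⟩ : ∃ g, c = a * g :=
    ⟨fun v => (a v)⁻¹ * c v, funext fun v => (mul_inv_cancel_left₀ (ha v).ne' _).symm⟩
  rw [eval_diffOp_tetrahedron] at h1
  rw [eval_diffOp_diffOp_tetrahedron]
  simp only [Pi.mul_apply] at h1 ⊢
  obtain ⟨v, hv⟩ : ∃ v, g v ≠ 0 := by
    by_contra! h
    exact hne (by simp [linForm, h])
  have h0 := ha 0
  have h1' := ha 1
  have h2 := ha 2
  have h3 := ha 3
  -- The weights of the four faces, each opposite the vertex it omits; their sum is `F(a)`.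
  set p := a 1 * a 2 * a 3 with hp
  set q := a 0 * a 2 * a 3 with hq
  set r := a 0 * a 1 * a 3 with hr
  set s := a 0 * a 1 * a 2 with hs
  have pp : 0 < p := by positivity
  have qp : 0 < q := by positivity
  have rp : 0 < r := by positivity
  have sp : 0 < s := by positivity
  -- This sum of squares equals `L² - F(a) · H`, where `L` and `H` are the first and second
  -- derivatives along `c`. Since `L = 0`, `H` is negative.
  have hsos : 0 < (q * g 0 + p * g 1) ^ 2 + (r * g 0 + p * g 2) ^ 2 + (s * g 0 + p * g 3) ^ 2 +
      (r * g 1 + q * g 2) ^ 2 + (s * g 1 + q * g 3) ^ 2 + (s * g 2 + r * g 3) ^ 2 +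
      2 * (g 0 ^ 2 * (q * r + q * s + r * s) + g 1 ^ 2 * (p * r + p * s + r * s) +
        g 2 ^ 2 * (p * q + p * s + q * s) + g 3 ^ 2 * (p * q + p * r + q * r)) := by
    fin_cases v <;> simp only [Fin.zero_eta, Fin.mk_one, Fin.reduceFinMk] at hv <;> positivity
  have hW : 0 < p + q + r + s := by positivity
  refine neg_of_mul_neg_left (b := p + q + r + s) ?_ hW.le
  refine lt_of_eq_of_lt ?_ (neg_neg_of_pos hsos)
  have h4 : s * (g 0 + g 1 + g 2) + r * (g 0 + g 1 + g 3) + q * (g 0 + g 2 + g 3) +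
      p * (g 1 + g 2 + g 3) = 0 := by
    rw [← h1, hp, hq, hr, hs]
    ring
  have h5 : 2 * (a 0 * g 0 * (a 1 * g 1) * a 2 + a 0 * g 0 * (a 2 * g 2) * a 1 +
        a 1 * g 1 * (a 2 * g 2) * a 0) +
      (2 * (a 0 * g 0 * (a 1 * g 1) * a 3 + a 0 * g 0 * (a 3 * g 3) * a 1 +
        a 1 * g 1 * (a 3 * g 3) * a 0) +
      (2 * (a 0 * g 0 * (a 2 * g 2) * a 3 + a 0 * g 0 * (a 3 * g 3) * a 2 +
        a 2 * g 2 * (a 3 * g 3) * a 0) +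
      2 * (a 1 * g 1 * (a 2 * g 2) * a 3 + a 1 * g 1 * (a 3 * g 3) * a 2 +
        a 2 * g 2 * (a 3 * g 3) * a 1))) =
      2 * (s * (g 0 * g 1 + g 0 * g 2 + g 1 * g 2) + r * (g 0 * g 1 + g 0 * g 3 + g 1 * g 3) +
        q * (g 0 * g 2 + g 0 * g 3 + g 2 * g 3) + p * (g 1 * g 2 + g 1 * g 3 + g 2 * g 3)) := by
    rw [hp, hq, hr, hs]
    ring
  rw [h5]
  clear_value p q r s
  linear_combination (s * (g 0 + g 1 + g 2) + r * (g 0 + g 1 + g 3) + q * (g 0 + g 2 + g 3) +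
      p * (g 1 + g 2 + g 3)) * h4

theorem satisfiesHodgeRiemann_tetrahedron {a : tetrahedron.Vertex → ℝ} (ha : ∀ v, 0 < a v) :
    tetrahedron.SatisfiesHodgeRiemann (tetrahedron.ell a) := by
  rw [satisfiesHodgeRiemann_ell_iff]
  exact hodgeRiemann_cubic (setPoly_isHomogeneous tetrahedron.card_of_mem_faces) a
    (eval_setPoly_pos tetrahedron.faces_nonempty ha) fun _ => tetrahedron_hessian_neg ha

theorem eval_diffOp_octahedron (a c : Fin 6 → ℝ) :
    eval a (diffOp (linForm c) (setPoly octahedronFaces)) =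
      (c 0 + c 5) * ((a 1 + a 3) * (a 2 + a 4)) + (c 1 + c 3) * ((a 0 + a 5) * (a 2 + a 4)) +
        (c 2 + c 4) * ((a 0 + a 5) * (a 1 + a 3)) := by
  rw [eval_diffOp_linForm_setPoly, octahedronFaces]
  iterate 7 rw [Finset.sum_insert (by decide), first_derivative_triple (by decide) (by decide) (by decide)]
  rw [Finset.sum_singleton, first_derivative_triple (by decide) (by decide) (by decide)]
  ring

theorem eval_diffOp_diffOp_octahedron (a c : Fin 6 → ℝ) :
    eval a (diffOp (linForm c) (diffOp (linForm c) (setPoly octahedronFaces))) =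
      2 * ((c 0 + c 5) * (c 1 + c 3) * (a 2 + a 4) + (c 0 + c 5) * (c 2 + c 4) * (a 1 + a 3) +
        (c 1 + c 3) * (c 2 + c 4) * (a 0 + a 5)) := by
  rw [eval_diffOp_linForm_linForm_setPoly, octahedronFaces]
  iterate 7 rw [Finset.sum_insert (by decide), second_derivative_triple (by decide) (by decide) (by decide)]
  rw [Finset.sum_singleton, second_derivative_triple (by decide) (by decide) (by decide)]
  ring

theorem octahedron_hessian_neg {a c : Fin 6 → ℝ} (ha : ∀ v, 0 < a v)
    (h1 : eval a (diffOp (linForm c) (setPoly octahedronFaces)) = 0)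
    (hne : diffOp (linForm c) (setPoly octahedronFaces) ≠ 0) :
    eval a (diffOp (linForm c) (diffOp (linForm c) (setPoly octahedronFaces))) < 0 := by
  have hc : ¬ (c 0 + c 5 = 0 ∧ c 1 + c 3 = 0 ∧ c 2 + c 4 = 0) := by
    rintro ⟨hx, hy, hz⟩
    refine hne (MvPolynomial.funext fun b => ?_)
    rw [eval_diffOp_octahedron, hx, hy, hz]
    simp
  rw [eval_diffOp_octahedron] at h1
  rw [eval_diffOp_diffOp_octahedron]
  have hx := add_pos (ha 0) (ha 5)
  have hy := add_pos (ha 1) (ha 3)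
  have hz := add_pos (ha 2) (ha 4)
  -- Everything depends only on sums over antipodal pairs, because `F = (x₀ + x₅)(x₁ + x₃)(x₂ +
  -- x₄)`. With `L` the first and `H` the second derivative, `xyz · H = L² -` the squares below.
  generalize a 0 + a 5 = x at *
  generalize a 1 + a 3 = y at *
  generalize a 2 + a 4 = z at *
  generalize c 0 + c 5 = p at *
  generalize c 1 + c 3 = q at *
  generalize c 2 + c 4 = r at *
  have hsos : 0 < (p * (y * z)) ^ 2 + (q * (x * z)) ^ 2 + (r * (x * y)) ^ 2 := by
    by_cases hp : p = 0
    · by_cases hq : q = 0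
      · have hr : r ≠ 0 := fun hr => hc ⟨hp, hq, hr⟩
        positivity
      · positivity
    · positivity
  refine neg_of_mul_neg_left (b := x * y * z) ?_ (by positivity)
  linear_combination (p * (y * z) + q * (x * z) + r * (x * y)) * h1 + hsos

theorem satisfiesHodgeRiemann_octahedron {a : octahedron.Vertex → ℝ} (ha : ∀ v, 0 < a v) :
    octahedron.SatisfiesHodgeRiemann (octahedron.ell a) := by
  rw [satisfiesHodgeRiemann_ell_iff]
  exact hodgeRiemann_cubic (setPoly_isHomogeneous octahedron.card_of_mem_faces) a
    (eval_setPoly_pos octahedron.faces_nonempty ha) fun _ => octahedron_hessian_neg ha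

/-! ### The cube and the icosahedron -/

theorem isStrongLefschetzElement_ell_of_certificate {P : PlatonicSolid} {a : P.Vertex → ℤ}
    (ha : ∀ v, 0 < a v) (N : P.Vertex → P.Vertex → ℤ) {d : ℤ} (hd : d ≠ 0)
    (hN : ∀ t v, ∑ T ∈ P.faces with v ∈ T, (∏ u ∈ T, a u) * ∑ u ∈ T.erase v, N t u =
      if v = t then d else 0)
    (h2 : P.faceSize = 5 → ∀ d : P.Vertex → P.Vertex → ℝ, (∀ u v, d u v = d v u) →
      (∀ p q, p ≠ q → ∑ T ∈ P.faces with p ∈ T ∧ q ∈ T, (∏ v ∈ T, (a v : ℝ)) *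
        ∑ u ∈ (T.erase q).erase p, ∑ v ∈ ((T.erase q).erase p).erase u, d u v = 0) →
      ∀ T ∈ P.faces, ∀ u ∈ T, ∀ v ∈ T, u ≠ v → d u v = 0) :
    P.IsStrongLefschetzElement (P.ell fun v => (a v : ℝ)) := by
  rw [isStrongLefschetzElement_ell_iff]
  exact isStrongLefschetz_setPoly P.faces_nonempty P.card_of_mem_faces
    (by cases P <;> decide) (fun v => Int.cast_pos.2 (ha v))
    (fun _ hg => eq_zero_of_certificate N hd hN hg) h2

/-- Nine times the inverse of the Hessian of the cube. -/
def cubeInverse : Fin 8 → Fin 8 → ℤ := ![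
  ![2, 2, -1, 2, 2, -1, -4, -1],
  ![2, 2, 2, -1, -1, 2, -1, -4],
  ![-1, 2, 2, 2, -4, -1, 2, -1],
  ![2, -1, 2, 2, -1, -4, -1, 2],
  ![2, -1, -4, -1, 2, 2, -1, 2],
  ![-1, 2, -1, -4, 2, 2, 2, -1],
  ![-4, -1, 2, -1, -1, 2, 2, 2],
  ![-1, -4, -1, 2, 2, -1, 2, 2]]

theorem isStrongLefschetzElement_cube :
    cube.IsStrongLefschetzElement (cube.ell fun _ => 1) := by
  have h := isStrongLefschetzElement_ell_of_certificate (P := cube) (a := fun _ => 1)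
    (fun _ => one_pos) cubeInverse (d := 9) (by decide) (by decide +kernel)
    (fun h => absurd h (by decide))
  simpa using h

theorem not_satisfiesHodgeRiemann_cube :
    ¬ cube.SatisfiesHodgeRiemann (cube.ell fun _ => 1) := by
  -- The vector is `1` on an edge and `-1` on the antipodal edge. It is a linear function on the
  -- cube, and the Hessian acts on it with eigenvalue `1`.
  have h := not_satisfiesHodgeRiemann_ell (P := cube) (fun _ => 1)
    (![1, 1, 0, 0, 0, 0, -1, -1] : Fin 8 → ℤ) (by decide +kernel) (by decide +kernel)
  simpa using h

/-- Ten times the inverse of the adjacency matrix of the icosahedron. -/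
def icosahedronInverse : Fin 12 → Fin 12 → ℤ := ![
  ![-2, 1, 1, 1, 1, 1, 0, 0, 0, 0, 0, -2],
  ![1, -2, 1, 0, 0, 1, 1, 1, 0, -2, 0, 0],
  ![1, 1, -2, 1, 0, 0, 0, 1, 1, 0, -2, 0],
  ![1, 0, 1, -2, 1, 0, -2, 0, 1, 1, 0, 0],
  ![1, 0, 0, 1, -2, 1, 0, -2, 0, 1, 1, 0],
  ![1, 1, 0, 0, 1, -2, 1, 0, -2, 0, 1, 0],
  ![0, 1, 0, -2, 0, 1, -2, 1, 0, 0, 1, 1],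
  ![0, 1, 1, 0, -2, 0, 1, -2, 1, 0, 0, 1],
  ![0, 0, 1, 1, 0, -2, 0, 1, -2, 1, 0, 1],
  ![0, -2, 0, 1, 1, 0, 0, 0, 1, -2, 1, 1],
  ![0, 0, -2, 0, 1, 1, 1, 0, 0, 1, -2, 1],
  ![-2, 0, 0, 0, 0, 0, 1, 1, 1, 1, 1, -2]]

theorem isStrongLefschetzElement_icosahedron :
    icosahedron.IsStrongLefschetzElement (icosahedron.ell fun _ => 1) := by
  -- Each edge lies on two faces, so the Hessian is `2A` with `A` the adjacency matrix, and the
  -- certificate reads `2A N = 10`.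
  have h := isStrongLefschetzElement_ell_of_certificate (P := icosahedron) (a := fun _ => 1)
    (fun _ => one_pos) icosahedronInverse (d := 10) (by decide) (by decide +kernel)
    (fun h => absurd h (by decide))
  simpa using h

theorem not_satisfiesHodgeRiemann_icosahedron :
    ¬ icosahedron.SatisfiesHodgeRiemann (icosahedron.ell fun _ => 1) := by
  -- Signs `+, +, -, -` along the path `1, 2, 3, 9`: two edges join equal signs, one joins opposite
  -- signs, and no other edge joins these vertices.
  have h := not_satisfiesHodgeRiemann_ell (P := icosahedron) (fun _ => 1)
    (![0, 1, 1, -1, 0, 0, 0, 0, 0, -1, 0, 0] : Fin 12 → ℤ) (by decide +kernel)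
    (by decide +kernel)
  simpa using h

/-! ### The dodecahedron -/

/-- The vertices of the faces of the dodecahedron in cyclic order. -/
def dodecahedronCycle : Fin 12 → Fin 5 → Fin 20 := ![
  ![0, 1, 2, 3, 4], ![0, 1, 6, 18, 5], ![1, 2, 7, 19, 6], ![2, 3, 8, 15, 7], ![3, 4, 9, 16, 8],
  ![0, 4, 9, 17, 5], ![10, 11, 12, 13, 14], ![8, 15, 10, 11, 16], ![9, 16, 11, 12, 17],
  ![5, 17, 12, 13, 18], ![6, 18, 13, 14, 19], ![7, 15, 10, 14, 19]]

/-- The vertex set of a face of the dodecahedron. -/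
def dodecahedronFace (f : Fin 12) : Finset (Fin 20) := Finset.univ.image (dodecahedronCycle f)

/-- The number of the edge from position `i` to position `i + 1` of a face. -/
def dodecahedronEdge : Fin 12 → Fin 5 → Fin 30 := ![
  ![0, 3, 5, 7, 1], ![0, 4, 12, 11, 2], ![3, 6, 15, 13, 4], ![5, 8, 16, 14, 6],
  ![7, 9, 18, 17, 8], ![1, 9, 19, 10, 2], ![20, 23, 25, 27, 21], ![16, 22, 20, 24, 17],
  ![18, 24, 23, 26, 19], ![10, 26, 25, 28, 11], ![12, 28, 27, 29, 13], ![14, 22, 21, 29, 15]]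

/-- The two occurrences of an edge on a face. -/
def dodecahedronFlag : Fin 30 → Fin 2 → Fin 12 × Fin 5 := ![
  ![(0, 0), (1, 0)], ![(0, 4), (5, 0)], ![(1, 4), (5, 4)], ![(0, 1), (2, 0)], ![(1, 1), (2, 4)],
  ![(0, 2), (3, 0)], ![(2, 1), (3, 4)], ![(0, 3), (4, 0)], ![(3, 1), (4, 4)], ![(4, 1), (5, 1)],
  ![(5, 3), (9, 0)], ![(1, 3), (9, 4)], ![(1, 2), (10, 0)], ![(2, 3), (10, 4)],
  ![(3, 3), (11, 0)], ![(2, 2), (11, 4)], ![(3, 2), (7, 0)], ![(4, 3), (7, 4)], ![(4, 2), (8, 0)],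
  ![(5, 2), (8, 4)], ![(6, 0), (7, 2)], ![(6, 4), (11, 2)], ![(7, 1), (11, 1)], ![(6, 1), (8, 2)],
  ![(7, 3), (8, 1)], ![(6, 2), (9, 2)], ![(8, 3), (9, 1)], ![(6, 3), (10, 2)], ![(9, 3), (10, 1)],
  ![(10, 3), (11, 3)]]

/-- Positive vertex weights that equal one away from a single vertex. -/
def dodecahedronPerturbation (v : Fin 20) : ℤ := if v = 0 then 2 else 1

/-- The product of the weights of the vertices of a face. -/
def dodecahedronFaceWeight : Fin 12 → ℤ := ![2, 2, 1, 1, 1, 2, 1, 1, 1, 1, 1, 1]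

/-- The matrix `720` times the inverse of the Hessian in degree one. -/
def dodecahedronVertexInverse : Fin 20 → Fin 20 → ℤ := ![
  ![-315, -60, 120, 120, -60, -60, 120, 150, 150, 120, -420, -150, 150, 150, -150, -150, 150, 120,
    120, 150],
  ![-60, -156, 60, 204, -12, -12, 60, -84, 228, -84, -180, -108, 36, 228, -36, -36, 36, -84, 204,
    -84],
  ![120, 60, -138, 186, 204, -84, -102, -192, -60, -66, 180, 0, -72, 120, 252, -72, -108, -174,
    -66, -48],
  ![120, 204, 186, -138, 60, -84, -66, -60, -192, -102, 180, 252, 120, -72, 0, -72, -48, -66, -174,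
    -108],
  ![-60, -12, 204, 60, -156, -12, -84, 228, -84, 60, -180, -36, 228, 36, -108, -36, -84, 204, -84,
    36],
  ![-60, -12, -84, -84, -12, -156, 204, 36, 36, 204, -180, -36, -84, -84, -36, -108, 228, 60, 60,
    228],
  ![120, 60, -102, -66, -84, 204, -138, -48, 120, -174, 180, 0, -108, -60, -72, 252, -72, -66, 186,
    -192],
  ![150, -84, -192, -60, 228, 36, -48, -284, -58, 120, 300, -132, -394, -98, 354, 138, -98, -72,
    -108, 212],
  ![150, 228, -60, -192, -84, 36, 120, -58, -284, -48, 300, 354, -98, -394, -132, 138, 212, -108,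
    -72, -98],
  ![120, -84, -66, -102, 60, 204, -174, 120, -48, -138, 180, -72, -60, -108, 0, 252, -192, 186,
    -66, -72],
  ![-420, -180, 180, 180, -180, -180, 180, 300, 300, 180, -900, -180, 300, 300, -180, -180, 300,
    180, 180, 300],
  ![-150, -108, 0, 252, -36, -36, 0, -132, 354, -72, -180, -324, 138, 354, -18, -18, 138, -72, 252,
    -132],
  ![150, 36, -72, 120, 228, -84, -108, -394, -98, -60, 300, 138, -284, 212, 354, -132, -58, -192,
    -48, -98],
  ![150, 228, 120, -72, 36, -84, -60, -98, -394, -108, 300, 354, 212, -284, 138, -132, -98, -48,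
    -192, -58],
  ![-150, -36, 252, 0, -108, -36, -72, 354, -132, 0, -180, -18, 354, 138, -324, -18, -132, 252,
    -72, 138],
  ![-150, -36, -72, -72, -36, -108, 252, 138, 138, 252, -180, -18, -132, -132, -18, -324, 354, 0,
    0, 354],
  ![150, 36, -108, -48, -84, 228, -72, -98, 212, -192, 300, 138, -58, -98, -132, 354, -284, -60,
    120, -394],
  ![120, -84, -174, -66, 204, 60, -66, -72, -108, 186, 180, -72, -192, -48, 252, 0, -60, -138,
    -102, 120],
  ![120, 204, -66, -174, -84, 60, 186, -108, -72, -66, 180, 252, -48, -192, -72, 0, 120, -102,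
    -138, -60],
  ![150, -84, -48, -108, 36, 228, -192, 212, -98, -72, 300, -132, -98, -58, 138, 354, -394, 120,
    -60, -284]]

/-- The matrix `1008` times the inverse of the Hessian in degree two, reduced to the edges. -/
def dodecahedronEdgeInverse : Fin 30 → Fin 30 → ℤ := ![
  ![110, -30, -30, 34, 34, 116, 114, 6, -26, 34, 34, 6, 116, 114, -36, 168, 48, -112, -110, -164,
    -204, 48, 48, -36, -36, -112, -110, 48, -26, -36],
  ![-30, 110, -30, 6, 34, 116, -26, 34, 114, 34, 6, 34, -164, -110, 48, -112, -36, 168, 114, 116,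
    48, -204, 48, 48, -36, -112, -26, -36, -110, -36],
  ![-30, -30, 110, 34, 6, -164, -110, 34, -110, 6, 34, 34, 116, -26, -36, -112, -36, -112, -26,
    116, 48, 48, -204, -36, 48, 168, 114, -36, 114, 48],
  ![34, 6, 34, 10, -46, -96, 134, 206, -20, -46, 10, -46, -40, 50, -18, -140, 24, 56, -20, 156,
    -60, 66, -60, -18, 24, 112, -118, -228, 50, 24],
  ![34, 34, 6, -46, 10, -40, 50, -46, 50, 10, -46, 206, -96, 134, 24, -140, -228, 112, -118, 156,
    -60, -60, 66, 24, -18, 56, -20, 24, -20, -18],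
  ![116, 116, -164, -96, -40, -120, 150, -96, 150, -40, 156, 156, 76, -18, -138, -84, -138, -84,
    -18, 76, -138, -138, 240, 114, 72, 112, -172, 114, -172, 72],
  ![114, -26, -110, 134, 50, 150, 292, -20, 341, 50, -118, -20, -18, 292, 183, 224, 78, -56, -247,
    -172, -216, -27, 225, -195, 57, -224, -331, 78, -247, -69],
  ![6, 34, 34, 206, -46, -96, -20, 10, 134, -46, -46, 10, 156, -20, 24, 56, -18, -140, 50, -40, 66,
    -60, -60, -228, 24, 112, 50, -18, -118, 24],
  ![-26, 114, -110, -20, 50, 150, 341, 134, 292, 50, -20, -118, -172, -247, 78, -56, 183, 224, 292,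
    -18, -27, -216, 225, 78, -69, -224, -247, -195, -331, 57],
  ![34, 34, 6, -46, 10, -40, 50, -46, 50, 10, 206, -46, 156, -118, -228, 112, 24, -140, 134, -96,
    -60, -60, 66, 24, -18, 56, -20, 24, -20, -18],
  ![34, 6, 34, 10, -46, 156, -118, -46, -20, 206, 10, -46, -40, 50, -18, 112, 24, 56, -20, -96,
    -60, 66, -60, -18, 24, -140, 134, 24, 50, -228],
  ![6, 34, 34, -46, 206, 156, -20, 10, -118, -46, -46, 10, -96, -20, 24, 56, -18, 112, 50, -40, 66,
    -60, -60, 24, -228, -140, 50, -18, 134, 24],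
  ![116, -164, 116, -40, -96, 76, -18, 156, -172, 156, -40, -96, -120, 150, 72, -84, 114, 112,
    -172, 76, -138, 240, -138, 72, 114, -84, -18, -138, 150, -138],
  ![114, -110, -26, 50, 134, -18, 292, -20, -247, -118, 50, -20, 150, 292, -69, 224, 78, -224,
    -331, -172, -216, 225, -27, 57, -195, -56, -247, 78, 341, 183],
  ![-36, 48, -36, -18, 24, -138, 183, 24, 78, -228, -18, 24, 72, -69, -46, -140, -25, -56, 78, 114,
    101, -4, 59, 38, -151, 280, -195, -151, 57, 395],
  ![168, -112, -112, -140, -140, -84, 224, 56, -56, 112, 112, 56, -84, 224, -140, -168, -56, 112,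
    -224, 112, -392, 280, 280, 280, 280, 112, -224, -56, -56, -140],
  ![48, -36, -36, 24, -228, -138, 78, -18, 183, 24, 24, -18, 114, 78, -25, -56, -46, -140, -69, 72,
    -4, 101, 59, -151, 395, 280, 57, 38, -195, -151],
  ![-112, 168, -112, 56, 112, -84, -56, -140, 224, -140, 56, 112, 112, -224, -56, 112, -140, -168,
    224, -84, 280, -392, 280, -56, -140, 112, -56, 280, -224, 280],
  ![-110, 114, -26, -20, -118, -18, -247, 50, 292, 134, -20, 50, -172, -331, 78, -224, -69, 224,
    292, 150, 225, -216, -27, 78, 183, -56, 341, 57, -247, -195],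
  ![-164, 116, 116, 156, 156, 76, -172, -40, -18, -96, -96, -40, 76, -172, 114, 112, 72, -84, 150,
    -120, 240, -138, -138, -138, -138, -84, 150, 72, -18, 114],
  ![-204, 48, 48, -60, -60, -138, -216, 66, -27, -60, -60, 66, -138, -216, 101, -392, -4, 280, 225,
    240, 374, -109, -109, 59, 59, 280, 225, -4, -27, 101],
  ![48, -204, 48, 66, -60, -138, -27, -60, -216, -60, 66, -60, 240, 225, -4, 280, 101, -392, -216,
    -138, -109, 374, -109, -4, 101, 280, -27, 59, 225, 59],
  ![48, 48, -204, -60, 66, 240, 225, -60, 225, 66, -60, -60, -138, -27, 59, 280, 59, 280, -27,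
    -138, -109, -109, 374, 101, -4, -392, -216, 101, -216, -4],
  ![-36, 48, -36, -18, 24, 114, -195, -228, 78, 24, -18, 24, 72, 57, 38, 280, -151, -56, 78, -138,
    59, -4, 101, -46, -25, -140, 183, 395, -69, -151],
  ![-36, -36, 48, 24, -18, 72, 57, 24, -69, -18, 24, -228, 114, -195, -151, 280, 395, -140, 183,
    -138, 59, 101, -4, -25, -46, -56, 78, -151, 78, 38],
  ![-112, -112, 168, 112, 56, 112, -224, 112, -224, 56, -140, -140, -84, -56, 280, 112, 280, 112,
    -56, -84, 280, 280, -392, -140, -56, -168, 224, -140, 224, -56],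
  ![-110, -26, 114, -118, -20, -172, -331, 50, -247, -20, 134, 50, -18, -247, -195, -224, 57, -56,
    341, 150, 225, -27, -216, 183, 78, 224, 292, -69, 292, 78],
  ![48, -36, -36, -228, 24, 114, 78, -18, -195, 24, 24, -18, -138, 78, -151, -56, 38, 280, 57, 72,
    -4, 59, 101, 395, -151, -140, -69, -46, 183, -25],
  ![-26, -110, 114, 50, -20, -172, -247, -118, -331, -20, 50, 134, 150, 341, 57, -56, -195, -224,
    -247, -18, -27, 225, -216, -69, 78, 224, 292, 183, 292, 78],
  ![-36, -36, 48, 24, -18, 72, -69, 24, 57, -18, -228, 24, -138, 183, 395, -140, -151, 280, -195,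
    114, 101, 59, -4, -151, 38, -56, 78, -25, 78, -46]]

theorem dodecahedron_vertex_certificate (t v : Fin 20) :
    ∑ T ∈ dodecahedronFaces with v ∈ T, (∏ u ∈ T, dodecahedronPerturbation u) *
      ∑ u ∈ T.erase v, dodecahedronVertexInverse t u = if v = t then 720 else 0 := by
  revert t v
  decide +kernel

/-- The circulant row `(-1, -1, 3, 3, -1)` is what a pentagon contributes at an edge once its
diagonals are eliminated, after doubling. -/
theorem dodecahedron_edge_certificate (t l : Fin 30) :
    ∑ k : Fin 2, dodecahedronFaceWeight (dodecahedronFlag l k).1 *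
      ∑ i : Fin 5, (![-1, -1, 3, 3, -1] : Fin 5 → ℤ) i * dodecahedronEdgeInverse t
        (dodecahedronEdge (dodecahedronFlag l k).1 ((dodecahedronFlag l k).2 + i)) =
      if l = t then 1008 else 0 := by
  revert t l
  decide +kernel

/-! ### Incidence of vertices, edges and diagonals with the pentagons. -/

theorem dodecahedronFaces_eq : dodecahedronFaces = Finset.univ.image dodecahedronFace := by
  decide +kernel

theorem dodecahedronFace_injective : Function.Injective dodecahedronFace := by
  rw [← Set.injOn_univ, ← Finset.coe_univ, ← Finset.card_image_iff]
  decide +kernel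

theorem dodecahedronCycle_injective (f : Fin 12) : Function.Injective (dodecahedronCycle f) := by
  rw [← Set.injOn_univ, ← Finset.coe_univ, ← Finset.card_image_iff]
  revert f
  decide +kernel

theorem dodecahedron_prod_perturbation (f : Fin 12) :
    ∏ v ∈ dodecahedronFace f, dodecahedronPerturbation v = dodecahedronFaceWeight f := by
  revert f
  decide +kernel

theorem dodecahedron_erase_diagonal (f : Fin 12) (i : Fin 5) :
    ((dodecahedronFace f).erase (dodecahedronCycle f (i + 2))).erase (dodecahedronCycle f i) =
      {dodecahedronCycle f (i + 1), dodecahedronCycle f (i + 3), dodecahedronCycle f (i + 4)} := by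
  revert f i
  decide +kernel

theorem dodecahedron_erase_edge (f : Fin 12) (i : Fin 5) :
    ((dodecahedronFace f).erase (dodecahedronCycle f (i + 1))).erase (dodecahedronCycle f i) =
      {dodecahedronCycle f (i + 2), dodecahedronCycle f (i + 3), dodecahedronCycle f (i + 4)} := by
  revert f i
  decide +kernel

/-- This is what allows the diagonals to be eliminated one face at a time. -/
theorem dodecahedron_filter_diagonal (f : Fin 12) (i : Fin 5) :
    {T ∈ dodecahedronFaces | dodecahedronCycle f i ∈ T ∧ dodecahedronCycle f (i + 2) ∈ T} =
      {dodecahedronFace f} := by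
  revert f i
  decide +kernel

theorem dodecahedron_filter_edge (l : Fin 30) :
    {T ∈ dodecahedronFaces | dodecahedronCycle (dodecahedronFlag l 0).1 (dodecahedronFlag l 0).2 ∈ T
      ∧ dodecahedronCycle (dodecahedronFlag l 0).1 ((dodecahedronFlag l 0).2 + 1) ∈ T} =
      {dodecahedronFace (dodecahedronFlag l 0).1, dodecahedronFace (dodecahedronFlag l 1).1} := by
  revert l
  decide +kernel

theorem dodecahedronFlag_ne (l : Fin 30) :
    (dodecahedronFlag l 0).1 ≠ (dodecahedronFlag l 1).1 := by
  revert l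
  decide +kernel

theorem dodecahedron_edge_fiber (l : Fin 30) :
    Finset.univ.filter (fun x : Fin 12 × Fin 5 => dodecahedronEdge x.1 x.2 = l) =
      {dodecahedronFlag l 0, dodecahedronFlag l 1} := by
  revert l
  decide +kernel

/-- Positions on faces that carry the same edge have the same end points. -/
theorem dodecahedron_edge_endpoints (f : Fin 12) (i : Fin 5) :
    let x := dodecahedronFlag (dodecahedronEdge f i) 0
    (dodecahedronCycle f i = dodecahedronCycle x.1 x.2 ∧
      dodecahedronCycle f (i + 1) = dodecahedronCycle x.1 (x.2 + 1)) ∨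
    (dodecahedronCycle f i = dodecahedronCycle x.1 (x.2 + 1) ∧
      dodecahedronCycle f (i + 1) = dodecahedronCycle x.1 x.2) := by
  revert f i
  decide +kernel

theorem dodecahedronEdge_flag (l : Fin 30) (k : Fin 2) :
    dodecahedronEdge (dodecahedronFlag l k).1 (dodecahedronFlag l k).2 = l := by
  have h : dodecahedronFlag l k ∈
      Finset.univ.filter (fun x : Fin 12 × Fin 5 => dodecahedronEdge x.1 x.2 = l) := by
    rw [dodecahedron_edge_fiber]
    fin_cases k <;> simp
  exact (Finset.mem_filter.1 h).2

theorem sum_dodecahedronFlag (g : Fin 12 × Fin 5 → ℝ) :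
    ∑ f, ∑ i, g (f, i) = ∑ l, ∑ k, g (dodecahedronFlag l k) := by
  rw [← Fintype.sum_prod_type, ← Finset.sum_fiberwise Finset.univ
    (fun x : Fin 12 × Fin 5 => dodecahedronEdge x.1 x.2)]
  refine Finset.sum_congr rfl fun l _ => ?_
  rw [dodecahedron_edge_fiber, Finset.sum_pair fun h => dodecahedronFlag_ne l (by rw [h]),
    Fin.sum_univ_two]

/-- The reduction to the edges of the linear system on the pairs of vertices of a pentagon. -/
theorem pentagon_reduction {e d : Fin 5 → ℝ} (h : ∀ i, d (i + 1) + d (i + 4) + e (i + 3) = 0)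
    (i : Fin 5) : 2 * (e (i + 2) + d (i + 2) + e (i + 3)) =
      ∑ k, ((![-1, -1, 3, 3, -1] : Fin 5 → ℤ) k : ℝ) * e (i + k) := by
  have h0 := h 0
  have h1 := h 1
  have h2 := h 2
  have h3 := h 3
  have h4 := h 4
  simp only [Fin.isValue, Fin.reduceAdd] at h0 h1 h2 h3 h4
  -- An alternating sum of the five equations isolates `2 d (i + 2)`.
  fin_cases i <;> simp [Fin.sum_univ_five] <;> linarith

/-- The relations `d j = -d (j + 3)` run around a cycle of odd length five, so `d j = -d j`. -/
theorem pentagon_diagonals_eq_zero {d : Fin 5 → ℝ} (h : ∀ i, d (i + 1) + d (i + 4) = 0)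
    (i : Fin 5) : d i = 0 := by
  have h0 := h 0
  have h1 := h 1
  have h2 := h 2
  have h3 := h 3
  have h4 := h 4
  simp only [Fin.isValue, Fin.reduceAdd] at h0 h1 h2 h3 h4
  fin_cases i <;> simp <;> linarith

/-- The circulant form of a pentagon is symmetric. -/
theorem pentagon_symm (e y : Fin 5 → ℝ) :
    ∑ i, y i * ∑ k, ((![-1, -1, 3, 3, -1] : Fin 5 → ℤ) k : ℝ) * e (i + k) =
      ∑ i, e i * ∑ k, ((![-1, -1, 3, 3, -1] : Fin 5 → ℤ) k : ℝ) * y (i + k) := by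
  simp [Fin.sum_univ_five]
  ring

/-- The reduced system on the edges of the dodecahedron has only the trivial solution. -/
theorem dodecahedron_edges_eq_zero {e : Fin 30 → ℝ}
    (h : ∀ l, ∑ k : Fin 2, (dodecahedronFaceWeight (dodecahedronFlag l k).1 : ℝ) *
      ∑ i : Fin 5, ((![-1, -1, 3, 3, -1] : Fin 5 → ℤ) i : ℝ) *
        e (dodecahedronEdge (dodecahedronFlag l k).1 ((dodecahedronFlag l k).2 + i)) = 0)
    (t : Fin 30) : e t = 0 := by
  -- Each edge occurs on exactly two faces, so the pairing regroups as a sum over faces of circulant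
  -- forms, which are symmetric.
  have key : ∀ e y : Fin 30 → ℝ, ∑ l, y l * ∑ k : Fin 2,
      (dodecahedronFaceWeight (dodecahedronFlag l k).1 : ℝ) *
        ∑ i : Fin 5, ((![-1, -1, 3, 3, -1] : Fin 5 → ℤ) i : ℝ) *
          e (dodecahedronEdge (dodecahedronFlag l k).1 ((dodecahedronFlag l k).2 + i)) =
      ∑ f, (dodecahedronFaceWeight f : ℝ) * ∑ i, y (dodecahedronEdge f i) *
        ∑ k, ((![-1, -1, 3, 3, -1] : Fin 5 → ℤ) k : ℝ) * e (dodecahedronEdge f (i + k)) := by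
    intro e y
    simp_rw [Finset.mul_sum Finset.univ (fun i => y (dodecahedronEdge _ i) * _)]
    rw [sum_dodecahedronFlag fun x => (dodecahedronFaceWeight x.1 : ℝ) *
      (y (dodecahedronEdge x.1 x.2) * ∑ k, ((![-1, -1, 3, 3, -1] : Fin 5 → ℤ) k : ℝ) *
        e (dodecahedronEdge x.1 (x.2 + k)))]
    refine Finset.sum_congr rfl fun l _ => ?_
    rw [Finset.mul_sum]
    refine Finset.sum_congr rfl fun k _ => ?_
    rw [dodecahedronEdge_flag]
    ring
  have h1 := key e fun l => (dodecahedronEdgeInverse t l : ℝ)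
  have h2 := key (fun l => (dodecahedronEdgeInverse t l : ℝ)) e
  simp_rw [fun f => pentagon_symm (fun i => e (dodecahedronEdge f i))
    (fun i => (dodecahedronEdgeInverse t (dodecahedronEdge f i) : ℝ))] at h1
  rw [← h2] at h1
  simp_rw [h, mul_zero, Finset.sum_const_zero] at h1
  have h3 : ∀ l, ∑ k : Fin 2, (dodecahedronFaceWeight (dodecahedronFlag l k).1 : ℝ) *
      ∑ i : Fin 5, ((![-1, -1, 3, 3, -1] : Fin 5 → ℤ) i : ℝ) * (dodecahedronEdgeInverse t
        (dodecahedronEdge (dodecahedronFlag l k).1 ((dodecahedronFlag l k).2 + i)) : ℝ) =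
      if l = t then 1008 else 0 := fun l => by
    exact_mod_cast dodecahedron_edge_certificate t l
  simp_rw [h3] at h1
  simpa using h1.symm

theorem dodecahedronFaceWeight_ne_zero (f : Fin 12) : dodecahedronFaceWeight f ≠ 0 := by
  revert f
  decide

theorem dodecahedron_prod_perturbation_real (f : Fin 12) :
    ∏ v ∈ dodecahedronFace f, (dodecahedronPerturbation v : ℝ) = dodecahedronFaceWeight f := by
  exact_mod_cast dodecahedron_prod_perturbation f

/-- The system of the Hessian in degree two of the dodecahedron has only the trivial solution. -/
theorem dodecahedron_pairs_eq_zero {d : Fin 20 → Fin 20 → ℝ} (hd : ∀ u v, d u v = d v u)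
    (h : ∀ p q, p ≠ q → ∑ T ∈ dodecahedronFaces with p ∈ T ∧ q ∈ T,
      (∏ v ∈ T, (dodecahedronPerturbation v : ℝ)) *
        ∑ u ∈ (T.erase q).erase p, ∑ v ∈ ((T.erase q).erase p).erase u, d u v = 0) :
    ∀ T ∈ dodecahedronFaces, ∀ u ∈ T, ∀ v ∈ T, u ≠ v → d u v = 0 := by
  have hne : ∀ f {i j : Fin 5}, i ≠ j → dodecahedronCycle f i ≠ dodecahedronCycle f j :=
    fun f i j hij => (dodecahedronCycle_injective f).ne hij
  have hdiag : ∀ f i, d (dodecahedronCycle f (i + 1)) (dodecahedronCycle f (i + 1 + 2)) +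
      d (dodecahedronCycle f (i + 4)) (dodecahedronCycle f (i + 4 + 2)) +
      d (dodecahedronCycle f (i + 3)) (dodecahedronCycle f (i + 3 + 1)) = 0 := by
    intro f i
    have h1 := h (dodecahedronCycle f i) (dodecahedronCycle f (i + 2)) (hne f (by simp))
    rw [dodecahedron_filter_diagonal, Finset.sum_singleton, dodecahedron_erase_diagonal,
      sum_erase_triple (hne f (by simp)) (hne f (by simp)) (hne f (by simp)) hd,
      dodecahedron_prod_perturbation_real] at h1
    have h2 : (dodecahedronFaceWeight f : ℝ) ≠ 0 :=
      Int.cast_ne_zero.2 (dodecahedronFaceWeight_ne_zero f)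
    have h3 := (mul_eq_zero.1 ((mul_eq_zero.1 h1).resolve_left h2)).resolve_left two_ne_zero
    rw [hd (dodecahedronCycle f (i + 1)) (dodecahedronCycle f (i + 4))] at h3
    have e1 : i + 1 + 2 = i + 3 := by clear * -; revert i; decide
    have e2 : i + 4 + 2 = i + 1 := by clear * -; revert i; decide
    have e3 : i + 3 + 1 = i + 4 := by clear * -; revert i; decide
    rw [e1, e2, e3]
    exact h3
  have hred := fun f => pentagon_reduction
    (e := fun i => d (dodecahedronCycle f i) (dodecahedronCycle f (i + 1)))
    (d := fun i => d (dodecahedronCycle f i) (dodecahedronCycle f (i + 2))) (hdiag f)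
  -- Symmetry of `d` makes its value on an edge independent of the face and of the direction of
  -- travel.
  obtain ⟨e, he⟩ : ∃ e : Fin 30 → ℝ, ∀ f i,
      d (dodecahedronCycle f i) (dodecahedronCycle f (i + 1)) = e (dodecahedronEdge f i) := by
    refine ⟨fun l => d (dodecahedronCycle (dodecahedronFlag l 0).1 (dodecahedronFlag l 0).2)
      (dodecahedronCycle (dodecahedronFlag l 0).1 ((dodecahedronFlag l 0).2 + 1)), fun f i => ?_⟩
    obtain ⟨h1, h2⟩ | ⟨h1, h2⟩ := dodecahedron_edge_endpoints f i
    · rw [h1, h2]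
    · rw [h1, h2, hd]
  have herase : ∀ f i, ∑ u ∈ ((dodecahedronFace f).erase (dodecahedronCycle f (i + 1))).erase
        (dodecahedronCycle f i),
      ∑ v ∈ (((dodecahedronFace f).erase (dodecahedronCycle f (i + 1))).erase
        (dodecahedronCycle f i)).erase u, d u v =
      ∑ k, ((![-1, -1, 3, 3, -1] : Fin 5 → ℤ) k : ℝ) * e (dodecahedronEdge f (i + k)) := by
    intro f i
    rw [dodecahedron_erase_edge,
      sum_erase_triple (hne f (by simp)) (hne f (by simp)) (hne f (by simp)) hd]
    -- The factor `2` in `pentagon_reduction` matches the two orderings of each pair in the double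
    -- sum.
    simp_rw [← he, ← hred f i]
    have e1 : i + 2 + 1 = i + 3 := by clear * -; revert i; decide
    have e2 : i + 2 + 2 = i + 4 := by clear * -; revert i; decide
    have e3 : i + 3 + 1 = i + 4 := by clear * -; revert i; decide
    rw [e1, e2, e3]
  have hzero : ∀ t, e t = 0 := dodecahedron_edges_eq_zero fun l => by
    have h1 := h _ _ (hne (dodecahedronFlag l 0).1
      (i := (dodecahedronFlag l 0).2) (j := (dodecahedronFlag l 0).2 + 1) (by simp))
    rw [dodecahedron_filter_edge, Finset.sum_pair
      (dodecahedronFace_injective.ne (dodecahedronFlag_ne l)), herase,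
      dodecahedron_prod_perturbation_real, dodecahedron_prod_perturbation_real] at h1
    rw [Fin.sum_univ_two, ← herase (dodecahedronFlag l 1).1]
    rw [← h1]
    -- The second face may traverse the edge backwards, which only swaps the two erasures.
    obtain ⟨h2, h3⟩ | ⟨h2, h3⟩ :=
      dodecahedron_edge_endpoints (dodecahedronFlag l 1).1 (dodecahedronFlag l 1).2 <;>
      rw [dodecahedronEdge_flag] at h2 h3
    · rw [h2, h3]
    · rw [h2, h3, Finset.erase_right_comm]
  have hedge : ∀ f i, d (dodecahedronCycle f i) (dodecahedronCycle f (i + 1)) = 0 :=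
    fun f i => by rw [he, hzero]
  have hdiag' : ∀ f i, d (dodecahedronCycle f i) (dodecahedronCycle f (i + 2)) = 0 := fun f =>
    pentagon_diagonals_eq_zero (d := fun i => d (dodecahedronCycle f i)
      (dodecahedronCycle f (i + 2))) fun i => by simpa [hedge] using hdiag f i
  intro T hT u hu v hv huv
  rw [dodecahedronFaces_eq] at hT
  obtain ⟨f, -, rfl⟩ := Finset.mem_image.1 hT
  obtain ⟨i, -, rfl⟩ := Finset.mem_image.1 hu
  obtain ⟨j, -, rfl⟩ := Finset.mem_image.1 hv
  have hij : i ≠ j := fun hij => huv (by rw [hij])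
  have cases : ∀ i j : Fin 5, i ≠ j → j = i + 1 ∨ j = i + 2 ∨ i = j + 1 ∨ i = j + 2 := by
    decide
  obtain rfl | rfl | rfl | rfl := cases i j hij
  · exact hedge f i
  · exact hdiag' f i
  · rw [hd]
    exact hedge f j
  · rw [hd]
    exact hdiag' f j

theorem dodecahedronPerturbation_pos (v : Fin 20) : 0 < dodecahedronPerturbation v := by
  revert v
  decide

/-- The perturbation is needed: at `a = 1` the degree-one Hessian is `A² + 2A - 3 = (A - 1)(A + 3)`,
and `1` is an eigenvalue of the adjacency matrix `A` of the dodecahedron. -/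
theorem isStrongLefschetzElement_dodecahedron :
    dodecahedron.IsStrongLefschetzElement
      (dodecahedron.ell fun v => (dodecahedronPerturbation v : ℝ)) :=
  isStrongLefschetzElement_ell_of_certificate (P := dodecahedron) (d := 720)
    dodecahedronPerturbation_pos dodecahedronVertexInverse (by decide)
    dodecahedron_vertex_certificate fun _ _ hd => dodecahedron_pairs_eq_zero hd

theorem not_satisfiesHodgeRiemann_dodecahedron :
    ¬ dodecahedron.SatisfiesHodgeRiemann
      (dodecahedron.ell fun v => (dodecahedronPerturbation v : ℝ)) :=
  -- The vector vanishes at the perturbed vertex, so only face weights enter. The first derivative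
  -- is `5 + 5 - 4 - 3 - 3 + 3 - 3 = 0` and the second is `2`.
  not_satisfiesHodgeRiemann_ell (P := dodecahedron) dodecahedronPerturbation
    (![0, 1, 0, 0, 0, 1, 0, 0, 0, -1, 0, -1, -1, 0, 1, -1, 0, 0, 0, 0] : Fin 20 → ℤ)
    (by decide +kernel) (by decide +kernel)

theorem not_satisfiesHodgeRiemann_dodecahedronWeight :
    ¬ dodecahedron.SatisfiesHodgeRiemann (dodecahedron.ell dodecahedronWeight) := by
  -- Take `-1` on the face `Φ` and `1` on `S`. In the first derivative `Φ` gives `-5` and the five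
  -- faces with one vertex in `S` give `1` each; in the second, `Φ` gives `20` and its five
  -- neighbours `2` each.
  have h := not_satisfiesHodgeRiemann_ell (P := dodecahedron)
    (fun v => if 5 ≤ v.val ∧ v.val ≤ 9 then 0 else 1)
    (![-1, -1, -1, -1, -1, 1, 1, 1, 1, 1, 0, 0, 0, 0, 0, 0, 0, 0, 0, 0] : Fin 20 → ℤ)
    (by decide +kernel) (by decide +kernel)
  have hw : dodecahedronWeight = fun v => ((if 5 ≤ v.val ∧ v.val ≤ 9 then 0 else 1 : ℤ) : ℝ) :=
    funext fun v => by
      rw [dodecahedronWeight]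
      push_cast
      rfl
  rwa [hw]

end PlatonicSolid

end

open PlatonicSolid in
theorem mainTheorem1 :
    -- all five algebras have the strong Lefschetz property
    (∀ P : PlatonicSolid, P.HasStrongLefschetzProperty) ∧
    -- tetrahedron and octahedron, on the positive orthant
    (∀ P : PlatonicSolid, P = .tetrahedron ∨ P = .octahedron →
      ∀ a : P.Vertex → ℝ, (∀ v, 0 < a v) →
        P.IsStrongLefschetzElement (P.ell a) ∧ P.SatisfiesHodgeRiemann (P.ell a)) ∧
    -- cube and icosahedron, with respect to the sum of all the `∂_v`
    (∀ P : PlatonicSolid, P = .cube ∨ P = .icosahedron →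
      P.IsStrongLefschetzElement (P.ell fun _ => 1) ∧
        ¬ P.SatisfiesHodgeRiemann (P.ell fun _ => 1)) ∧
    -- dodecahedron, with respect to a specific linear element
    ¬ PlatonicSolid.dodecahedron.SatisfiesHodgeRiemann
      (PlatonicSolid.dodecahedron.ell PlatonicSolid.dodecahedronWeight) ∧
    -- dodecahedron, with respect to a strong Lefschetz element
    (∃ a : PlatonicSolid.dodecahedron.Vertex → ℝ, (∀ v, 0 < a v) ∧
      PlatonicSolid.dodecahedron.IsStrongLefschetzElement (PlatonicSolid.dodecahedron.ell a) ∧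
      ¬ PlatonicSolid.dodecahedron.SatisfiesHodgeRiemann (PlatonicSolid.dodecahedron.ell a)) := by
  refine ⟨fun P => ?_, ?_, ?_, not_satisfiesHodgeRiemann_dodecahedronWeight,
    _, fun v => Int.cast_pos.2 (dodecahedronPerturbation_pos v),
    isStrongLefschetzElement_dodecahedron, not_satisfiesHodgeRiemann_dodecahedron⟩
  · cases P
    · exact ⟨_, isStrongLefschetzElement_of_satisfiesHodgeRiemann
        (satisfiesHodgeRiemann_tetrahedron fun _ => one_pos)⟩
    · exact ⟨_, isStrongLefschetzElement_cube⟩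
    · exact ⟨_, isStrongLefschetzElement_of_satisfiesHodgeRiemann
        (satisfiesHodgeRiemann_octahedron fun _ => one_pos)⟩
    · exact ⟨_, isStrongLefschetzElement_dodecahedron⟩
    · exact ⟨_, isStrongLefschetzElement_icosahedron⟩
  · rintro P (rfl | rfl) a ha
    · have h := satisfiesHodgeRiemann_tetrahedron ha
      exact ⟨isStrongLefschetzElement_of_satisfiesHodgeRiemann h, h⟩
    · have h := satisfiesHodgeRiemann_octahedron ha
      exact ⟨isStrongLefschetzElement_of_satisfiesHodgeRiemann h, h⟩
  · rintro P (rfl | rfl)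
    · exact ⟨isStrongLefschetzElement_cube, not_satisfiesHodgeRiemann_cube⟩
    · exact ⟨isStrongLefschetzElement_icosahedron, not_satisfiesHodgeRiemann_icosahedron⟩
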